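/- **Setting.** Let $\mathcal A$ be a set of $K\ge 1$ actions, and let $\Pi$ (stochastic policies $\pi:\mathcal X\to\Delta(\mathcal A)$) and $\Psi$ (reward decoders $\psi:\mathcal Y\to[0,1]$) be finite classes. In each round a context $x\sim d_0$ is drawn, the learner chooses an action $a$, a pair $(r,y)\in\{0,1\}\times\mathcal Y$ is drawn from a fixed conditional law given $(x,a)$, and the learner sees only $(x,a,y)$. Put $R(x,a)=\mathbb E[r\mid x,a]$, $V(\pi)=\mathbb E_{x\sim d_0,\,a\sim\pi(\cdot\mid x)}[R(x,a)]$, $\pi^\star\in\arg\max_{\pi\in\Pi}V(\pi)$, $\Delta\psi=\mathbb E[\psi(y)\mid r=1]-\mathbb E[\psi(y)\mid r=0]$, $\psi^\star\in\arg\max_{\psi\in\Psi}\Delta\psi$, and let $\pi_{\rm bad}$ be the uniformly random policy. Assume that $y$ is independent of $(x,a)$ given $r$, and that $(V(\pi^\star)-V(\pi_{\rm bad}))\,\Delta\psi^\star\ge V(\pi_{\rm bad})+\eta$ for some $\eta>0$. **Algorithm E2G** with schedule $(n_i)_{i\ge1}$. In round $i=1,2,\dots$: take one uniformly random action and add the observed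 $(x,a,y)$ to the exploration data, giving $D_i$ with $|D_i|=i$; let $(\pi_i,\psi_i)$ maximize $\frac1{i}\sum_{(x,a,y)\in D_i}K\psi(y)\pi(a\mid x)-\frac1{i}\sum_{(x,a,y)\in D_i}\psi(y)$ over $\Pi\times\Psi$; then execute $\pi_i$ for $n_i$ steps. **Theorem.** Let $\delta\in(0,1)$, $T\ge1$ and $\iota=\log(2T|\Pi||\Psi|/\delta)$. There are universal constants $C>0$, $m\in\mathbb N$ and a function $T_0(K,\eta)$ such that the following holds. Run E2G with $$n_i=0\ \text{ for } i\le w,\qquad n_i=\Big\lfloor\sqrt{i/(K\iota)}\Big\rfloor\ \text{ for } i>w,\qquad w=\frac{2K^2\iota}{\eta^2}.$$ Then $$\mathrm{Regret}(T)\ \le\ C\,\iota^{m}\left(\frac{K^{1/3}T^{2/3}}{\Delta\psi^\star}+\frac{2K^2}{\eta^2}\right),$$ that is, the regret is $\tilde O\big(K^{1/3}T^{2/3}/\Delta\psi^\star+2K^2/\eta^2\big)$. With the shorter warm-up $w=2K^2/\eta^2$ the same bound holds for all $T\ge T_0(K,\eta)$. The bound holds for the expected regret $TV(\pi^\star)-\mathbb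 E\big[\sum_{t=1}^TR(x_t,a_t)\big]$; it also holds with probability at least $1-\delta$ for the regret $TV(\pi^\star)-\sum_{t=1}^TV(\pi^{(t)})$ of the executed policies ($\pi^{(t)}$ is the policy from which $a_t$ is drawn), and with probability at least $1-\delta$ for the realized regret $TV(\pi^\star)-\sum_{t=1}^TR(x_t,a_t)$. -/

import Mathlib

open MeasureTheory ProbabilityTheory

namespace IGL

/-- One full interaction `((x, a), (r, y))`: context, action, latent binary reward
(`true` is `r = 1`), feedback vector. -/
abbrev Interaction (X Y : Type*) (K : ℕ) := (X × Fin K) × (Bool × Y)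

/-- What the learner sees of an interaction: `(x, a, y)`, without the reward. -/
abbrev Observation (X Y : Type*) (K : ℕ) := X × Fin K × Y

/-- The observed part of an interaction. -/
def observe {X Y : Type*} {K : ℕ} (z : Interaction X Y K) : Observation X Y K :=
  (z.1.1, z.1.2, z.2.2)

/-- An interaction-grounded learning problem with `K` actions, a class of `N` stochastic policies
and a class of `M` reward decoders. The contexts have law `d₀`; given `(x, a)`, the pair `(r, y)` is
drawn jointly from `env (x, a)`. -/
structure Problem (X Y : Type*) [MeasurableSpace X] [MeasurableSpace Y] (K N M : ℕ) where
  d₀ : Measure X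
  [isProbabilityMeasure_d₀ : IsProbabilityMeasure d₀]
  env : Kernel (X × Fin K) (Bool × Y)
  [isMarkovKernel_env : IsMarkovKernel env]
  policy : Fin N → Kernel X (Fin K)
  [isMarkovKernel_policy : ∀ p, IsMarkovKernel (policy p)]
  decoder : Fin M → Y → ℝ
  measurable_decoder : ∀ q, Measurable (decoder q)
  decoder_mem : ∀ q y, decoder q y ∈ Set.Icc (0 : ℝ) 1

attribute [instance] Problem.isProbabilityMeasure_d₀ Problem.isMarkovKernel_env
  Problem.isMarkovKernel_policy

/-- The policy that selects an action uniformly at random. -/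
noncomputable def uniformPolicy (X : Type*) [MeasurableSpace X] (K : ℕ) : Kernel X (Fin K) :=
  Kernel.const X (uniformOn Set.univ)

instance {X : Type*} [MeasurableSpace X] {K : ℕ} [NeZero K] :
    IsMarkovKernel (uniformPolicy X K) := by
  have : IsProbabilityMeasure (uniformOn (Set.univ : Set (Fin K))) :=
    isProbabilityMeasure_uniformOn Set.finite_univ Set.univ_nonempty
  unfold uniformPolicy
  infer_instance

namespace Problem

variable {X Y : Type*} [MeasurableSpace X] [MeasurableSpace Y] {K N M : ℕ}

/-- The law of one interaction when the action is drawn from `π`. -/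
noncomputable def law (G : Problem X Y K N M) (π : Kernel X (Fin K)) :
    Measure (Interaction X Y K) :=
  (G.d₀ ⊗ₘ π) ⊗ₘ G.env

instance (G : Problem X Y K N M) (π : Kernel X (Fin K)) [IsMarkovKernel π] :
    IsProbabilityMeasure (G.law π) := by
  unfold law
  infer_instance

/-- `R(x, a) = E[r | x, a]`. -/
noncomputable def meanReward (G : Problem X Y K N M) (z : X × Fin K) : ℝ :=
  (G.env z).real {w | w.1 = true}

/-- `V(π)`, the expected return of a policy. -/
noncomputable def value (G : Problem X Y K N M) (π : Kernel X (Fin K)) : ℝ :=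
  ∫ z, G.meanReward z ∂(G.d₀ ⊗ₘ π)

/-- The law of one interaction with a uniformly random action, conditioned on `r = b`. -/
noncomputable def lawGiven (G : Problem X Y K N M) (b : Bool) : Measure (Interaction X Y K) :=
  cond (G.law (uniformPolicy X K)) {z | z.2.1 = b}

/-- Conditional independence: the feedback `y` is independent of `(x, a)` given the reward `r`. -/
def CondIndepFeedback (G : Problem X Y K N M) : Prop :=
  ∀ b : Bool, IndepFun (fun z : Interaction X Y K => z.1) (fun z => z.2.2) (G.lawGiven b)

/-- `Δψ = E[ψ(y) | r = 1] - E[ψ(y) | r = 0]`. -/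
noncomputable def decoderGap (G : Problem X Y K N M) (q : Fin M) : ℝ :=
  (∫ z, G.decoder q z.2.2 ∂(G.lawGiven true)) - ∫ z, G.decoder q z.2.2 ∂(G.lawGiven false)

/-- The objective maximized on exploration data `D`:
`E_D[K ψ(y) π(a | x)] - E_D[ψ(y)]`, with empirical means. -/
noncomputable def objective (G : Problem X Y K N M) {i : ℕ} (D : Fin i → Observation X Y K)
    (p : Fin N) (q : Fin M) : ℝ :=
  (∑ k, (K : ℝ) * G.decoder q (D k).2.2 * (G.policy p (D k).1).real {(D k).2.1}) / i
    - (∑ k, G.decoder q (D k).2.2) / i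

/-- A (measurable) rule that selects a maximizing policy-decoder pair for each data set; ties are
broken in an arbitrary way. -/
structure Oracle (G : Problem X Y K N M) where
  select : (i : ℕ) → (Fin i → Observation X Y K) → Fin N × Fin M
  measurable_select : ∀ i, Measurable (select i)
  isMax : ∀ i (D : Fin i → Observation X Y K) (p : Fin N) (q : Fin M),
    G.objective D p q ≤ G.objective D (select i D).1 (select i D).2

end Problem

/-! Time steps are `0, 1, 2, …` and rounds are `1, 2, 3, …`. Round `i` consists of one exploration
step followed by `n i` exploitation steps. -/

/-- The time step at which round `i ≥ 1` starts (with its exploration step). -/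
def roundStart (n : ℕ → ℕ) (i : ℕ) : ℕ := ∑ j ∈ Finset.Ico 1 i, (1 + n j)

/-- The round to which time step `t` belongs: the last round that starts at or before `t`. -/
def roundOf (n : ℕ → ℕ) (t : ℕ) : ℕ := Nat.findGreatest (fun i => roundStart n i ≤ t) (t + 1)

/-- Time step `t` is the exploration step of its round. -/
def IsExploration (n : ℕ → ℕ) (t : ℕ) : Prop := roundStart n (roundOf n t) = t

instance (n : ℕ → ℕ) (t : ℕ) : Decidable (IsExploration n t) :=
  inferInstanceAs (Decidable (_ = _))

theorem roundStart_mono (n : ℕ → ℕ) {i j : ℕ} (h : i ≤ j) : roundStart n i ≤ roundStart n j :=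
  Finset.sum_le_sum_of_subset (Finset.Ico_subset_Ico_right h)

theorem roundStart_roundOf_le (n : ℕ → ℕ) (t : ℕ) : roundStart n (roundOf n t) ≤ t :=
  Nat.findGreatest_spec (P := fun i => roundStart n i ≤ t) (Nat.zero_le (t + 1))
    (by simp [roundStart])

theorem roundStart_le_of_exploitation {n : ℕ → ℕ} {t : ℕ} (ht : ¬ IsExploration n (t + 1))
    (k : Fin (roundOf n (t + 1))) : roundStart n (k + 1) ≤ t := by
  have h1 := roundStart_mono n (show (k : ℕ) + 1 ≤ roundOf n (t + 1) from k.2)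
  have h2 := roundStart_roundOf_le n (t + 1)
  unfold IsExploration at ht
  omega

namespace Problem

variable {X Y : Type*} [MeasurableSpace X] [MeasurableSpace Y] {K N M : ℕ}

/-- The exploration data `D_i` available at the exploitation step `t + 1` of round `i`: the
observations at the exploration steps of the rounds `1, …, i`, read off from the past `h`. -/
def exploreData {n : ℕ → ℕ} {t : ℕ} (ht : ¬ IsExploration n (t + 1))
    (h : Finset.Iic t → Interaction X Y K) :
    Fin (roundOf n (t + 1)) → Observation X Y K :=
  fun k => observe (h ⟨roundStart n (k + 1),
    Finset.mem_Iic.2 (roundStart_le_of_exploitation ht k)⟩)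

/-- The policy `π_i` that is executed at the exploitation step `t + 1` of round `i`. -/
def learnedPolicy {G : Problem X Y K N M} (O : G.Oracle) {n : ℕ → ℕ} {t : ℕ}
    (ht : ¬ IsExploration n (t + 1)) (h : Finset.Iic t → Interaction X Y K) : Fin N :=
  (O.select _ (exploreData ht h)).1

theorem measurable_learnedPolicy {G : Problem X Y K N M} (O : G.Oracle) {n : ℕ → ℕ} {t : ℕ}
    (ht : ¬ IsExploration n (t + 1)) : Measurable (learnedPolicy O ht) := by
  refine measurable_fst.comp ((O.measurable_select _).comp (measurable_pi_lambda _ fun k => ?_))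
  unfold exploreData observe
  fun_prop

/-- The conditional law of the interaction at time step `t + 1` given the past: a uniformly random
action at exploration steps, and the learned policy at exploitation steps. -/
noncomputable def stepKernel {G : Problem X Y K N M} (O : G.Oracle) (n : ℕ → ℕ) (t : ℕ) :
    Kernel (Finset.Iic t → Interaction X Y K) (Interaction X Y K) :=
  if ht : IsExploration n (t + 1) then Kernel.const _ (G.law (uniformPolicy X K))
  else (Kernel.ofFunOfCountable fun p => G.law (G.policy p)).comap (learnedPolicy O ht)
    (measurable_learnedPolicy O ht)

instance [NeZero K] {G : Problem X Y K N M} (O : G.Oracle) (n : ℕ → ℕ) (t : ℕ) :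
    IsMarkovKernel (stepKernel O n t) := by
  unfold stepKernel
  split_ifs with ht
  · infer_instance
  · have : IsMarkovKernel (Kernel.ofFunOfCountable fun p => G.law (G.policy p)) :=
      ⟨fun p => inferInstanceAs (IsProbabilityMeasure (G.law (G.policy p)))⟩
    infer_instance

/-- The law of the infinite sequence of interactions produced by the E2G algorithm with
schedule `n`. -/
noncomputable def runLaw [NeZero K] {G : Problem X Y K N M} (O : G.Oracle) (n : ℕ → ℕ) :
    Measure (ℕ → Interaction X Y K) :=
  Kernel.trajMeasure (X := fun _ => Interaction X Y K) (G.law (uniformPolicy X K)) (stepKernel O n)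

/-- The policy from which the algorithm draws its action at time step `t`. -/
noncomputable def executedPolicy {G : Problem X Y K N M} (O : G.Oracle) (n : ℕ → ℕ) (t : ℕ)
    (ω : ℕ → Interaction X Y K) : Kernel X (Fin K) :=
  match t with
  | 0 => uniformPolicy X K
  | t + 1 =>
    if ht : IsExploration n (t + 1) then uniformPolicy X K
    else G.policy (learnedPolicy O ht fun s => ω s)

/-- The realized regret `T V⋆ - ∑_{t < T} R(x_t, a_t)` of a trajectory. -/
noncomputable def realizedRegret (G : Problem X Y K N M) (Vstar : ℝ) (T : ℕ)
    (ω : ℕ → Interaction X Y K) : ℝ :=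
  T * Vstar - ∑ t ∈ Finset.range T, G.meanReward (ω t).1

/-- The regret `T V⋆ - ∑_{t < T} V(π_t)` of the policies executed along a trajectory: each
`R(x_t, a_t)` is replaced by its conditional expectation given the past. -/
noncomputable def policyRegret {G : Problem X Y K N M} (O : G.Oracle) (n : ℕ → ℕ) (Vstar : ℝ)
    (T : ℕ) (ω : ℕ → Interaction X Y K) : ℝ :=
  T * Vstar - ∑ t ∈ Finset.range T, G.value (executedPolicy O n t ω)

/-- The regret `T V⋆ - E[∑_{t < T} R(x_t, a_t)]` of the algorithm. -/
noncomputable def regret [NeZero K] {G : Problem X Y K N M} (O : G.Oracle) (n : ℕ → ℕ) (Vstar : ℝ)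
    (T : ℕ) : ℝ :=
  T * Vstar - ∫ ω, ∑ t ∈ Finset.range T, G.meanReward (ω t).1 ∂(runLaw O n)

end Problem

/-- The complexity term `log (2 T |Ψ| |Π| / δ)`. -/
noncomputable def complexityTerm (T N M : ℕ) (δ : ℝ) : ℝ := Real.log (2 * T * M * N / δ)

/-- The schedule with warm-up length `w` and complexity term `c`: `n_i = 0` for `i ≤ w`, and
`n_i = ⌊√(i / (K c))⌋` for `i > w`. -/
noncomputable def schedule (K : ℕ) (c w : ℝ) (i : ℕ) : ℕ :=
  if (i : ℝ) ≤ w then 0 else ⌊Real.sqrt (i / (K * c))⌋₊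

end IGL

/-!
Under a uniformly random action the score `(K π(a | x) - 1) ψ(y)` of one exploration observation has
mean `Δψ (V(π) - V(π_bad))` (`integral_score`): given the reward, the feedback is independent of
`(x, a)`, so the mean feedback is an affine function of the mean reward with slope `Δψ`. The
identifiability assumption says that the optimal pair beats by `η` everything that a decoder with
`Δψ ≤ 0` can reach, which is at most `V(π_bad)`. So if the empirical means deviate by less than
`η / 2`, the selected decoder has a positive gap, and if they deviate by less than `ε`, the selected
policy has regret at most `2 ε / Δψ⋆` (`value_gap_le`).

Two deviation bounds are used for each round `i`, and both come from Chernoff's method. Hoeffding's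
inequality with `ε = η / 2` has exactly the exponent `i η² / (2 K²)` that matches the warm-up length
`2 K² c / η²`. Bernstein's inequality uses that the variance of the score is at most `K`
(`integral_score_sq_le`) and gives `ε = 4 √(K c / i)`. To fit both into the failure probability `δ`,
only one direction is counted for each pair: downwards for the optimal pair, upwards for the others.

A round after the warm-up has at most `√(i / (K c))` exploitation steps, so it costs `O(1 / Δψ⋆)`,
and since its length is at least `√(i / (K c))`, only `O((T² K c)^(1/3))` such rounds fit into `T`
steps (`card_rounds_le`). This bounds the sum of the step costs (`sum_stepCost_le`). With the shorter
warm-up, the rounds up to `2 K² c / η²` may fail; their total length is at most `c T^(2/3)` for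
large `T`.

The trajectory law is accessed only through its one-step disintegration (`lintegral_runLaw_step`),
from which exponential moments of adapted sums are bounded by induction (`measure_sum_ge_le_exp`).
This yields the bounds for the exploration data, and the Azuma–Hoeffding inequality by which the
realized regret follows from the regret of the executed policies. For the expected regret, a failure
of round `i` is charged to the steps of round `i` only (`regret_le_sum_add`); as a round fails with
probability at most `δ / T`, this costs at most `δ` altogether.
-/

namespace IGL

namespace Problem

variable {X Y : Type*} [MeasurableSpace X] [MeasurableSpace Y] {K N M : ℕ}

/-! ### Population identities -/

theorem measurable_meanReward (G : Problem X Y K N M) : Measurable G.meanReward :=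
  (Kernel.measurable_coe _ (measurable_fst (measurableSet_singleton true))).ennreal_toReal

theorem meanReward_mem (G : Problem X Y K N M) (z : X × Fin K) :
    G.meanReward z ∈ Set.Icc (0 : ℝ) 1 :=
  ⟨measureReal_nonneg, measureReal_le_one⟩

theorem measurable_prob_action (π : Kernel X (Fin K)) :
    Measurable fun z : X × Fin K => (π z.1).real {z.2} :=
  measurable_from_prod_countable_left fun a =>
    (Kernel.measurable_coe π (measurableSet_singleton a)).ennreal_toReal

theorem integrable_of_bound {α : Type*} [MeasurableSpace α] {μ : Measure α} [IsFiniteMeasure μ]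
    {f : α → ℝ} (hf : Measurable f) {c : ℝ} (hc : ∀ z, |f z| ≤ c) : Integrable f μ :=
  Integrable.of_bound hf.aestronglyMeasurable c (Filter.Eventually.of_forall hc)

theorem map_fst_law (G : Problem X Y K N M) (π : Kernel X (Fin K)) [IsMarkovKernel π] :
    (G.law π).map Prod.fst = G.d₀ ⊗ₘ π :=
  Measure.fst_compProd _ _

theorem integral_law_fst (G : Problem X Y K N M) (π : Kernel X (Fin K)) [IsMarkovKernel π]
    {f : X × Fin K → ℝ} (hf : Measurable f) :
    ∫ z, f z.1 ∂G.law π = ∫ z, f z ∂(G.d₀ ⊗ₘ π) := by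
  rw [← map_fst_law, integral_map measurable_fst.aemeasurable hf.aestronglyMeasurable]

theorem integral_law_meanReward (G : Problem X Y K N M) (π : Kernel X (Fin K))
    [IsMarkovKernel π] : ∫ z, G.meanReward z.1 ∂G.law π = G.value π :=
  integral_law_fst G π G.measurable_meanReward

theorem value_mem (G : Problem X Y K N M) (π : Kernel X (Fin K)) [IsMarkovKernel π] :
    G.value π ∈ Set.Icc (0 : ℝ) 1 := by
  refine ⟨integral_nonneg fun z => (G.meanReward_mem z).1, ?_⟩
  calc G.value π ≤ ∫ _, (1 : ℝ) ∂(G.d₀ ⊗ₘ π) := by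
        refine integral_mono (integrable_of_bound G.measurable_meanReward (c := 1) fun z => ?_)
          (integrable_const _) fun z => (G.meanReward_mem z).2
        rw [abs_of_nonneg (G.meanReward_mem z).1]
        exact (G.meanReward_mem z).2
    _ = 1 := by simp

theorem measurableSet_reward (b : Bool) :
    MeasurableSet {z : Interaction X Y K | z.2.1 = b} :=
  (measurable_fst.comp measurable_snd) (measurableSet_singleton b)

/-- Importance weighting: `K π(a | x)` is the density of the law of `(x, a)` under `π` with respect
to its law under the uniform policy. -/
theorem integral_importance_weight (G : Problem X Y K N M) [NeZero K] (π : Kernel X (Fin K))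
    [IsMarkovKernel π] {f : X × Fin K → ℝ} (hf : Measurable f) {c : ℝ} (hc : ∀ z, |f z| ≤ c) :
    ∫ z, K * (π z.1).real {z.2} * f z ∂(G.d₀ ⊗ₘ uniformPolicy X K) = ∫ z, f z ∂(G.d₀ ⊗ₘ π) := by
  have hK : (K : ℝ) ≠ 0 := by exact_mod_cast NeZero.ne K
  rw [Measure.integral_compProd, Measure.integral_compProd (integrable_of_bound hf hc)]
  · refine integral_congr_ae (Filter.Eventually.of_forall fun x => ?_)
    simp only
    rw [integral_fintype .of_finite, integral_fintype .of_finite]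
    refine Finset.sum_congr rfl fun a _ => ?_
    have : (uniformPolicy X K x).real {a} = (K : ℝ)⁻¹ := by
      simp [uniformPolicy, measureReal_def, uniformOn_univ]
    rw [this, smul_eq_mul, smul_eq_mul]
    field_simp
  · refine integrable_of_bound (c := K * 1 * c) ?_ fun z => ?_
    · exact ((measurable_prob_action π).const_mul _).mul hf
    · rw [abs_mul, abs_mul, Nat.abs_cast, abs_of_nonneg measureReal_nonneg]
      have : (π z.1).real {z.2} ≤ 1 := measureReal_le_one
      gcongr
      exact hc z

/-- Given the reward, the feedback is uncorrelated with functions of context and action. -/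
theorem setIntegral_mul_decoder (G : Problem X Y K N M) [NeZero K] (hG : G.CondIndepFeedback)
    (b : Bool) (q : Fin M) {f : X × Fin K → ℝ} (hf : Measurable f) :
    ∫ z in {z | z.2.1 = b}, f z.1 * G.decoder q z.2.2 ∂G.law (uniformPolicy X K)
      = (∫ z, G.decoder q z.2.2 ∂G.lawGiven b)
        * ∫ z in {z | z.2.1 = b}, f z.1 ∂G.law (uniformPolicy X K) := by
  set P := G.law (uniformPolicy X K) with hP
  set S : Set (Interaction X Y K) := {z | z.2.1 = b} with hS
  have hcond : ∀ g : Interaction X Y K → ℝ,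
      ∫ z in S, g z ∂P = P.real S * ∫ z, g z ∂G.lawGiven b := by
    intro g
    unfold lawGiven ProbabilityTheory.cond
    rw [integral_smul_measure, smul_eq_mul, ← hP, ← hS, ENNReal.toReal_inv, ← measureReal_def]
    by_cases h0 : P S = 0
    · simp [Measure.restrict_eq_zero.2 h0]
    · rw [mul_inv_cancel_left₀]
      exact (ENNReal.toReal_pos h0 (measure_ne_top _ _)).ne'
  rw [hcond, hcond]
  have := ((hG b).comp hf (G.measurable_decoder q)).integral_fun_mul_eq_mul_integral
    (by exact (hf.comp measurable_fst).aestronglyMeasurable)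
    (by exact ((G.measurable_decoder q).comp (measurable_snd.comp measurable_snd)).aestronglyMeasurable)
  simp only [Function.comp_def] at this
  rw [this]
  ring

theorem setIntegral_reward_true (G : Problem X Y K N M) (π : Kernel X (Fin K))
    [IsMarkovKernel π] {f : X × Fin K → ℝ} (hf : Measurable f) {c : ℝ} (hc : ∀ z, |f z| ≤ c) :
    ∫ z in {z | z.2.1 = true}, f z.1 ∂G.law π = ∫ z, f z * G.meanReward z ∂(G.d₀ ⊗ₘ π) := by
  rw [← integral_indicator (measurableSet_reward true)]
  have hi : Integrable (fun z : Interaction X Y K => f z.1) (G.law π) :=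
    integrable_of_bound (hf.comp measurable_fst) fun z => hc z.1
  unfold law at hi ⊢
  rw [Measure.integral_compProd (hi.indicator (measurableSet_reward true))]
  refine integral_congr_ae (Filter.Eventually.of_forall fun z => ?_)
  simp only
  have : (fun w : Bool × Y => ({z : Interaction X Y K | z.2.1 = true}.indicator
      (fun z => f z.1) (z, w))) = {w : Bool × Y | w.1 = true}.indicator fun _ => f z := by
    ext w
    simp [Set.indicator_apply]
  have hS : MeasurableSet {w : Bool × Y | w.1 = true} :=
    measurable_fst (measurableSet_singleton true)
  rw [this, integral_indicator_const _ hS, smul_eq_mul, mul_comm, meanReward]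

/-- Under a uniformly random action, the mean feedback is an affine function of the mean reward. -/
theorem integral_mul_decoder (G : Problem X Y K N M) [NeZero K] (hG : G.CondIndepFeedback)
    (q : Fin M) {f : X × Fin K → ℝ} (hf : Measurable f) {c : ℝ} (hc : ∀ z, |f z| ≤ c) :
    ∫ z, f z.1 * G.decoder q z.2.2 ∂G.law (uniformPolicy X K)
      = (∫ z, G.decoder q z.2.2 ∂G.lawGiven false) * ∫ z, f z ∂(G.d₀ ⊗ₘ uniformPolicy X K)
        + G.decoderGap q * ∫ z, f z * G.meanReward z ∂(G.d₀ ⊗ₘ uniformPolicy X K) := by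
  have hcompl : {z : Interaction X Y K | z.2.1 = true}ᶜ = {z | z.2.1 = false} := by
    ext z; simp
  have hi : Integrable (fun z : Interaction X Y K => f z.1) (G.law (uniformPolicy X K)) :=
    integrable_of_bound (hf.comp measurable_fst) fun z => hc z.1
  have hi' : Integrable (fun z : Interaction X Y K => f z.1 * G.decoder q z.2.2)
      (G.law (uniformPolicy X K)) := by
    refine integrable_of_bound (c := c) ((hf.comp measurable_fst).mul
      ((G.measurable_decoder q).comp (measurable_snd.comp measurable_snd))) fun z => ?_
    rw [abs_mul, abs_of_nonneg (G.decoder_mem q _).1]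
    nlinarith [hc z.1, abs_nonneg (f z.1), (G.decoder_mem q z.2.2).1, (G.decoder_mem q z.2.2).2]
  have h1 := integral_add_compl (measurableSet_reward true) hi
  have h2 := integral_add_compl (measurableSet_reward true) hi'
  rw [hcompl] at h1 h2
  rw [integral_law_fst G _ hf] at h1
  rw [← h2, setIntegral_mul_decoder G hG true q hf, setIntegral_mul_decoder G hG false q hf, ← h1,
    setIntegral_reward_true G _ hf hc, decoderGap]
  ring

/-- The contribution of one exploration observation to the objective of the pair `(p, q)`. -/
noncomputable def score (G : Problem X Y K N M) (p : Fin N) (q : Fin M)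
    (o : Observation X Y K) : ℝ :=
  (K * (G.policy p o.1).real {o.2.1} - 1) * G.decoder q o.2.2

theorem measurable_score (G : Problem X Y K N M) (p : Fin N) (q : Fin M) :
    Measurable (G.score p q) := by
  have h : Measurable fun o : Observation X Y K => (G.policy p o.1).real {o.2.1} :=
    (measurable_prob_action (G.policy p)).comp
      (measurable_fst.prodMk (measurable_fst.comp measurable_snd))
  exact ((h.const_mul _).sub_const 1).mul
    ((G.measurable_decoder q).comp (measurable_snd.comp measurable_snd))

theorem measurable_observe : Measurable (observe : Interaction X Y K → Observation X Y K) := by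
  unfold observe
  fun_prop

theorem score_mem (G : Problem X Y K N M) [NeZero K] (p : Fin N) (q : Fin M)
    (o : Observation X Y K) : G.score p q o ∈ Set.Icc (-1 : ℝ) (K - 1) := by
  have h0 : 0 ≤ (G.policy p o.1).real {o.2.1} := measureReal_nonneg
  have h1 : (G.policy p o.1).real {o.2.1} ≤ 1 := measureReal_le_one
  obtain ⟨h2, h3⟩ := G.decoder_mem q o.2.2
  have hK : (1 : ℝ) ≤ K := by exact_mod_cast NeZero.one_le
  have h4 : 0 ≤ (K : ℝ) * (G.policy p o.1).real {o.2.1} := by positivity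
  have h5 : (K : ℝ) * (G.policy p o.1).real {o.2.1} ≤ K := by nlinarith
  unfold score
  constructor <;> nlinarith

theorem objective_eq (G : Problem X Y K N M) {i : ℕ} (D : Fin i → Observation X Y K)
    (p : Fin N) (q : Fin M) : G.objective D p q = (∑ k, G.score p q (D k)) / i := by
  unfold objective score
  rw [← sub_div, ← Finset.sum_sub_distrib]
  congr 1
  exact Finset.sum_congr rfl fun k _ => by ring

/-- The population objective of `(p, q)` is `Δψ_q (V(π_p) - V(π_bad))`. -/
theorem integral_score (G : Problem X Y K N M) [NeZero K] (hG : G.CondIndepFeedback)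
    (p : Fin N) (q : Fin M) :
    ∫ z, G.score p q (observe z) ∂G.law (uniformPolicy X K)
      = G.decoderGap q * (G.value (G.policy p) - G.value (uniformPolicy X K)) := by
  have hm := measurable_prob_action (G.policy p)
  have hb : ∀ z : X × Fin K, |(K : ℝ) * (G.policy p z.1).real {z.2}| ≤ K := fun z => by
    have h0 : 0 ≤ (G.policy p z.1).real {z.2} := measureReal_nonneg
    have h1 : (G.policy p z.1).real {z.2} ≤ 1 := measureReal_le_one
    rw [abs_of_nonneg (by positivity)]
    exact mul_le_of_le_one_right (Nat.cast_nonneg K) h1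
  have hb1 : ∀ z : X × Fin K, |(K : ℝ) * (G.policy p z.1).real {z.2} - 1| ≤ K + 1 := fun z =>
    (abs_sub _ _).trans (by simpa using hb z)
  have hR : ∀ z : X × Fin K, |G.meanReward z| ≤ 1 := fun z => by
    rw [abs_of_nonneg (G.meanReward_mem z).1]
    exact (G.meanReward_mem z).2
  have hone := G.integral_importance_weight (G.policy p) (f := fun _ => 1) (c := 1)
    measurable_const (by simp)
  have hval := G.integral_importance_weight (G.policy p) G.measurable_meanReward hR
  simp only [mul_one, integral_const, probReal_univ, smul_eq_mul] at hone
  have h := G.integral_mul_decoder hG q ((hm.const_mul (K : ℝ)).sub_const 1) hb1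
  have e1 : ∫ z, ((K : ℝ) * (G.policy p z.1).real {z.2} - 1) ∂(G.d₀ ⊗ₘ uniformPolicy X K) = 0 := by
    rw [integral_sub (integrable_of_bound (hm.const_mul _) hb) (integrable_const _), hone]
    simp
  have e2 : ∫ z, ((K : ℝ) * (G.policy p z.1).real {z.2} - 1) * G.meanReward z
      ∂(G.d₀ ⊗ₘ uniformPolicy X K) = G.value (G.policy p) - G.value (uniformPolicy X K) := by
    simp only [sub_mul, one_mul]
    rw [integral_sub, hval]
    · rfl
    · refine integrable_of_bound (c := K * 1) ((hm.const_mul _).mul G.measurable_meanReward)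
        fun z => ?_
      rw [abs_mul]
      exact mul_le_mul (hb z) (hR z) (abs_nonneg _) (Nat.cast_nonneg K)
    · exact integrable_of_bound G.measurable_meanReward hR
  rw [e1, e2, mul_zero, zero_add] at h
  exact h

/-- The second moment of the score is at most `K`, although the score itself can be as large as
`K - 1`: the importance weight `K π(a | x)` is nonnegative, bounded by `K`, and has mean `1`. -/
theorem integral_score_sq_le (G : Problem X Y K N M) [NeZero K] (p : Fin N) (q : Fin M) :
    ∫ z, G.score p q (observe z) ^ 2 ∂G.law (uniformPolicy X K) ≤ K := by
  have hm := measurable_prob_action (G.policy p)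
  have hb : ∀ z : X × Fin K, (K : ℝ) * (G.policy p z.1).real {z.2} ∈ Set.Icc (0 : ℝ) K :=
    fun z => ⟨by positivity, mul_le_of_le_one_right (Nat.cast_nonneg K) measureReal_le_one⟩
  have hone := G.integral_importance_weight (G.policy p) (f := fun _ => 1) (c := 1)
    measurable_const (by simp)
  simp only [mul_one, integral_const, probReal_univ, smul_eq_mul] at hone
  have hint : Integrable (fun z : X × Fin K => (K : ℝ) * (G.policy p z.1).real {z.2})
      (G.d₀ ⊗ₘ uniformPolicy X K) := integrable_of_bound (hm.const_mul _) (c := K) fun z => by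
    rw [abs_of_nonneg (hb z).1]
    exact (hb z).2
  have hmeas : Measurable fun z : X × Fin K =>
      ((K : ℝ) - 2) * ((K : ℝ) * (G.policy p z.1).real {z.2}) + 1 :=
    ((hm.const_mul _).const_mul _).add_const 1
  have hmean : ∫ z, (((K : ℝ) - 2) * ((K : ℝ) * (G.policy p z.1).real {z.2}) + 1)
      ∂(G.d₀ ⊗ₘ uniformPolicy X K) = K - 1 := by
    rw [integral_add (hint.const_mul _) (integrable_const _), integral_const_mul, hone]
    simp
    ring
  rw [← integral_law_fst G _ hmeas] at hmean
  have hK : (1 : ℝ) ≤ K := by exact_mod_cast NeZero.one_le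
  refine le_trans (integral_mono_of_nonneg (Filter.Eventually.of_forall fun z => sq_nonneg _) ?_
    (Filter.Eventually.of_forall fun z => ?_)) (hmean.trans_le (by linarith))
  · refine integrable_of_bound (c := (K : ℝ) * K + 1 + 2 * K) (hmeas.comp measurable_fst)
      fun z => ?_
    have := hb z.1
    rw [abs_le]
    constructor <;> nlinarith [this.1, this.2]
  · have h1 := hb z.1
    have h2 := G.decoder_mem q z.2.2
    set u := (K : ℝ) * (G.policy p z.1.1).real {z.1.2}
    have e : G.score p q (observe z) = (u - 1) * G.decoder q z.2.2 := rfl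
    simp only
    rw [e, mul_pow]
    have h3 : G.decoder q z.2.2 ^ 2 ≤ 1 := by nlinarith [h2.1, h2.2]
    nlinarith [sq_nonneg (u - 1), h1.1, h1.2]

theorem integral_decoder_lawGiven_mem (G : Problem X Y K N M) (b : Bool) (q : Fin M) :
    ∫ z, G.decoder q z.2.2 ∂G.lawGiven b ∈ Set.Icc (0 : ℝ) 1 := by
  refine ⟨integral_nonneg fun z => (G.decoder_mem q _).1, ?_⟩
  have : IsZeroOrProbabilityMeasure (G.lawGiven b) := by unfold lawGiven; infer_instance
  calc ∫ z, G.decoder q z.2.2 ∂G.lawGiven b ≤ ∫ _, (1 : ℝ) ∂G.lawGiven b :=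
        integral_mono_of_nonneg (Filter.Eventually.of_forall fun z => (G.decoder_mem q _).1)
          (integrable_const _) (Filter.Eventually.of_forall fun z => (G.decoder_mem q _).2)
    _ ≤ 1 := by
        rw [integral_const, smul_eq_mul, mul_one]
        exact measureReal_le_one

theorem abs_decoderGap_le_one (G : Problem X Y K N M) (q : Fin M) : |G.decoderGap q| ≤ 1 := by
  obtain ⟨h1, h2⟩ := G.integral_decoder_lawGiven_mem true q
  obtain ⟨h3, h4⟩ := G.integral_decoder_lawGiven_mem false q
  rw [decoderGap, abs_le]
  constructor <;> linarith

/-! ### Exponential moments of the score -/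

/-- Hoeffding's lemma for the score, whose range has length `K`. -/
theorem integral_exp_score_le_hoeffding (G : Problem X Y K N M) [NeZero K] (p : Fin N) (q : Fin M)
    (l : ℝ) :
    ∫ z, Real.exp (l * (G.score p q (observe z)
      - ∫ z, G.score p q (observe z) ∂G.law (uniformPolicy X K))) ∂G.law (uniformPolicy X K)
      ≤ Real.exp ((K : ℝ) ^ 2 * l ^ 2 / 8) := by
  have h := (hasSubgaussianMGF_of_mem_Icc (μ := G.law (uniformPolicy X K))
    ((G.measurable_score p q).comp measurable_observe).aemeasurable
    (Filter.Eventually.of_forall fun z => G.score_mem p q (observe z))).mgf_le l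
  refine h.trans_eq ?_
  congr 1
  push_cast
  simp
  ring

theorem exp_le_one_add_add_sq {x : ℝ} (hx : |x| ≤ 1) : Real.exp x ≤ 1 + x + x ^ 2 := by
  have := (abs_le.1 (Real.abs_exp_sub_one_sub_id_le hx)).2
  linarith

/-- Bernstein's bound for the exponential moments of the score: it has variance at most `K`, and
`e ^ x ≤ 1 + x + x ^ 2` for `|x| ≤ 1`. -/
theorem integral_exp_score_le_bernstein (G : Problem X Y K N M) [NeZero K] (p : Fin N) (q : Fin M)
    {l : ℝ} (hl : |l| * K ≤ 1) :
    ∫ z, Real.exp (l * (G.score p q (observe z)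
      - ∫ z, G.score p q (observe z) ∂G.law (uniformPolicy X K))) ∂G.law (uniformPolicy X K)
      ≤ Real.exp ((K : ℝ) * l ^ 2) := by
  set P := G.law (uniformPolicy X K)
  set f : Interaction X Y K → ℝ := fun z => G.score p q (observe z)
  have hfm : Measurable f := (G.measurable_score p q).comp measurable_observe
  have hf : ∀ z, f z ∈ Set.Icc (-1 : ℝ) (K - 1) := fun z => G.score_mem p q (observe z)
  have hfi : Integrable f P := Integrable.of_mem_Icc _ _ hfm.aemeasurable (.of_forall hf)
  have hfi2 : Integrable (fun z => f z ^ 2) P := by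
    refine integrable_of_bound (c := (1 + K : ℝ) ^ 2) (by fun_prop) fun z => ?_
    rw [abs_of_nonneg (sq_nonneg _), sq_le_sq, abs_of_nonneg (by positivity : (0 : ℝ) ≤ 1 + K),
      abs_le]
    constructor <;> linarith [(hf z).1, (hf z).2]
  set m := ∫ z, f z ∂P with hmdef
  have hm : m ∈ Set.Icc (-1 : ℝ) (K - 1) := by
    constructor
    · have := integral_mono (μ := P) (integrable_const (-1)) hfi fun z => (hf z).1
      simpa using this
    · have := integral_mono (μ := P) hfi (integrable_const ((K : ℝ) - 1)) fun z => (hf z).2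
      simpa using this
  have hsmall : ∀ z, |l * (f z - m)| ≤ 1 := fun z => by
    rw [abs_mul]
    refine le_trans (mul_le_mul_of_nonneg_left ?_ (abs_nonneg l)) hl
    rw [abs_le]
    constructor <;> linarith [(hf z).1, (hf z).2, hm.1, hm.2]
  have hlin : Integrable (fun z => l * (f z - m)) P := (hfi.sub (integrable_const _)).const_mul _
  have hsq : ∀ z, (l * (f z - m)) ^ 2 = l ^ 2 * (f z ^ 2 - 2 * m * f z + m ^ 2) := fun z => by ring
  have hquad : Integrable (fun z => (l * (f z - m)) ^ 2) P := by
    simp only [hsq]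
    exact ((hfi2.sub (hfi.const_mul _)).add (integrable_const _)).const_mul _
  calc ∫ z, Real.exp (l * (f z - m)) ∂P
      ≤ ∫ z, (1 + l * (f z - m) + (l * (f z - m)) ^ 2) ∂P :=
        integral_mono_of_nonneg (.of_forall fun z => (Real.exp_pos _).le)
          (((integrable_const _).add hlin).add hquad)
          (.of_forall fun z => exp_le_one_add_add_sq (hsmall z))
    _ = 1 + l ^ 2 * ((∫ z, f z ^ 2 ∂P) - m ^ 2) := by
        have hlin' : Integrable (fun z => 1 + l * (f z - m)) P := (integrable_const _).add hlin
        have hfi' : Integrable (fun z => f z ^ 2 - 2 * m * f z) P := hfi2.sub (hfi.const_mul _)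
        rw [integral_add hlin' hquad,
          integral_add (integrable_const _) hlin, integral_const_mul,
          integral_sub hfi (integrable_const _)]
        simp only [hsq]
        rw [integral_const_mul, integral_add hfi' (integrable_const _),
          integral_sub hfi2 (hfi.const_mul _), integral_const_mul, ← hmdef]
        simp only [integral_const, probReal_univ, smul_eq_mul, one_mul]
        ring
    _ ≤ 1 + K * l ^ 2 := by
        have := G.integral_score_sq_le p q
        have : l ^ 2 * ((∫ z, f z ^ 2 ∂P) - m ^ 2) ≤ l ^ 2 * K :=
          mul_le_mul_of_nonneg_left (by linarith [sq_nonneg m]) (sq_nonneg l)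
        linarith
    _ ≤ Real.exp (K * l ^ 2) := by linarith [Real.add_one_le_exp ((K : ℝ) * l ^ 2)]

/-! ### The law of the trajectory -/

instance [NeZero K] {G : Problem X Y K N M} (O : G.Oracle) (n : ℕ → ℕ) (t : ℕ)
    (ω : ℕ → Interaction X Y K) : IsMarkovKernel (executedPolicy O n t ω) := by
  unfold executedPolicy
  split
  · infer_instance
  · split_ifs <;> infer_instance

@[simp]
theorem executedPolicy_zero {G : Problem X Y K N M} (O : G.Oracle) (n : ℕ → ℕ)
    (ω : ℕ → Interaction X Y K) : executedPolicy O n 0 ω = uniformPolicy X K := rfl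

theorem executedPolicy_of_isExploration {G : Problem X Y K N M} (O : G.Oracle) {n : ℕ → ℕ} {t : ℕ}
    (ht : IsExploration n t) (ω : ℕ → Interaction X Y K) :
    executedPolicy O n t ω = uniformPolicy X K := by
  cases t with
  | zero => rfl
  | succ t => exact dif_pos ht

theorem executedPolicy_of_not_isExploration {G : Problem X Y K N M} (O : G.Oracle) {n : ℕ → ℕ}
    {t : ℕ} (ht : ¬ IsExploration n (t + 1)) (ω : ℕ → Interaction X Y K) :
    executedPolicy O n (t + 1) ω = G.policy (learnedPolicy O ht fun s => ω s) :=
  dif_neg ht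

theorem stepKernel_frestrictLe {G : Problem X Y K N M} (O : G.Oracle) (n : ℕ → ℕ) (t : ℕ)
    (ω : ℕ → Interaction X Y K) :
    stepKernel O n t (Preorder.frestrictLe t ω) = G.law (executedPolicy O n (t + 1) ω) := by
  unfold stepKernel
  split_ifs with ht
  · rw [executedPolicy_of_isExploration O ht]
    rfl
  · rw [executedPolicy_of_not_isExploration O ht]
    rfl

theorem executedPolicy_congr {G : Problem X Y K N M} (O : G.Oracle) (n : ℕ → ℕ) (t : ℕ)
    {ω ω' : ℕ → Interaction X Y K} (h : ∀ s < t, ω s = ω' s) :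
    executedPolicy O n t ω = executedPolicy O n t ω' := by
  cases t with
  | zero => rfl
  | succ t =>
    have : (fun s : Finset.Iic t => ω s) = fun s : Finset.Iic t => ω' s :=
      funext fun s => h _ (Nat.lt_succ_of_le (Finset.mem_Iic.1 s.2))
    simp only [executedPolicy, this]

theorem measurable_value_executedPolicy {G : Problem X Y K N M} (O : G.Oracle) (n : ℕ → ℕ)
    (t : ℕ) : Measurable fun ω => G.value (executedPolicy O n t ω) := by
  cases t with
  | zero =>
    simp only [executedPolicy_zero]
    exact measurable_const
  | succ t =>
    by_cases ht : IsExploration n (t + 1)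
    · simp only [executedPolicy_of_isExploration O ht]
      exact measurable_const
    · simp only [executedPolicy_of_not_isExploration O ht]
      exact (measurable_of_countable fun p => G.value (G.policy p)).comp
        ((measurable_learnedPolicy O ht).comp (by fun_prop))

/-- A trajectory with a prescribed past up to time `t`, constant from then on. -/
def extendPast {α : Type*} (t : ℕ) (h : Finset.Iic t → α) (s : ℕ) : α :=
  h ⟨min s t, Finset.mem_Iic.2 (min_le_right _ _)⟩

theorem measurable_extendPast {α : Type*} [MeasurableSpace α] (t : ℕ) :
    Measurable (extendPast t : (Finset.Iic t → α) → ℕ → α) :=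
  measurable_pi_lambda _ fun _ => measurable_pi_apply _

theorem extendPast_frestrictLe {α : Type*} (t : ℕ) (ω : ℕ → α) {s : ℕ} (hs : s < t + 1) :
    extendPast t (Preorder.frestrictLe t ω) s = ω s := by
  simp [extendPast, min_eq_left (Nat.lt_succ_iff.1 hs)]

theorem map_eval_zero_runLaw [NeZero K] {G : Problem X Y K N M} (O : G.Oracle) (n : ℕ → ℕ) :
    (runLaw O n).map (fun ω => ω 0) = G.law (uniformPolicy X K) := by
  have h : (runLaw O n).map (Preorder.frestrictLe 0) = (G.law (uniformPolicy X K)).map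
      (MeasurableEquiv.piUnique fun _ : Finset.Iic 0 => Interaction X Y K).symm := by
    unfold runLaw Kernel.trajMeasure
    rw [Measure.map_comp _ _ (by fun_prop), Kernel.traj_map_frestrictLe, Kernel.partialTraj_self,
      Measure.id_comp]
  have h2 : (fun ω : ℕ → Interaction X Y K => ω 0)
      = (fun h : Finset.Iic 0 → Interaction X Y K => h ⟨0, by simp⟩) ∘ Preorder.frestrictLe 0 := rfl
  rw [h2, ← Measure.map_map (by fun_prop) (by fun_prop), h, Measure.map_map (by fun_prop)
    (by fun_prop)]
  exact Measure.map_id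

instance [NeZero K] {G : Problem X Y K N M} (O : G.Oracle) (n : ℕ → ℕ) :
    IsProbabilityMeasure (runLaw O n) := by
  unfold runLaw
  infer_instance

/-- Conditionally on the past, the interaction at time `t` has the law of the executed policy. -/
theorem lintegral_runLaw_step [NeZero K] {G : Problem X Y K N M} (O : G.Oracle) (n : ℕ → ℕ)
    (t : ℕ) {f : (ℕ → Interaction X Y K) → Interaction X Y K → ENNReal}
    (hf : Measurable (Function.uncurry f))
    (hdep : ∀ ω ω', (∀ s < t, ω s = ω' s) → f ω = f ω') :
    ∫⁻ ω, f ω (ω t) ∂runLaw O n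
      = ∫⁻ ω, ∫⁻ z, f ω z ∂G.law (executedPolicy O n t ω) ∂runLaw O n := by
  cases t with
  | zero =>
    obtain ⟨z₀⟩ : Nonempty (Interaction X Y K) :=
      (G.law (uniformPolicy X K)).nonempty_of_neZero
    have hc : ∀ ω, f ω = f fun _ => z₀ := fun ω => hdep _ _ fun s hs => absurd hs (Nat.not_lt_zero s)
    have hm : Measurable (f fun _ => z₀) := hf.comp measurable_prodMk_left
    simp only [hc, executedPolicy, lintegral_const, measure_univ, mul_one]
    rw [← map_eval_zero_runLaw O n, lintegral_map hm (measurable_pi_apply 0)]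
  | succ t =>
    have hm : Measurable fun x : (Finset.Iic t → Interaction X Y K) × Interaction X Y K =>
        f (extendPast t x.1) x.2 :=
      hf.comp (((measurable_extendPast t).comp measurable_fst).prodMk measurable_snd)
    have hext : ∀ ω, f (extendPast t (Preorder.frestrictLe t ω)) = f ω := fun ω =>
      hdep _ _ fun s hs => extendPast_frestrictLe t ω hs
    have hmeq := Kernel.map_frestrictLe_trajMeasure_compProd_eq_map_trajMeasure
      (X := fun _ => Interaction X Y K) (μ₀ := G.law (uniformPolicy X K)) (κ := stepKernel O n)
      (a := t)
    have hcalc := congrArg (fun μ => ∫⁻ x, f (extendPast t x.1) x.2 ∂μ) hmeq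
    rw [lintegral_map hm (by fun_prop), Measure.lintegral_compProd hm, lintegral_map
      (hm.lintegral_kernel_prod_right') (by fun_prop)] at hcalc
    simp only [hext, stepKernel_frestrictLe] at hcalc
    exact hcalc.symm

/-- A product of factors, each of conditional mean at most `1` given the past, has mean at
most `1`. -/
theorem lintegral_prod_le_one [NeZero K] {G : Problem X Y K N M} (O : G.Oracle) (n : ℕ → ℕ)
    {g : ℕ → (ℕ → Interaction X Y K) → Interaction X Y K → ENNReal}
    (hg : ∀ t, Measurable (Function.uncurry (g t)))
    (hdep : ∀ t ω ω', (∀ s < t, ω s = ω' s) → g t ω = g t ω')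
    (hle : ∀ t ω, ∫⁻ z, g t ω z ∂G.law (executedPolicy O n t ω) ≤ 1) (T : ℕ) :
    ∫⁻ ω, ∏ t ∈ Finset.range T, g t ω (ω t) ∂runLaw O n ≤ 1 := by
  have hm : ∀ t, Measurable fun ω : ℕ → Interaction X Y K => g t ω (ω t) := fun t =>
    (hg t).comp (measurable_id.prodMk (measurable_pi_apply t))
  induction T with
  | zero => simp
  | succ T ih =>
    have hmp : Measurable fun ω : ℕ → Interaction X Y K => ∏ t ∈ Finset.range T, g t ω (ω t) :=
      Finset.measurable_prod _ fun t _ => hm t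
    simp only [Finset.prod_range_succ]
    rw [lintegral_runLaw_step O n T
      (f := fun ω z => (∏ t ∈ Finset.range T, g t ω (ω t)) * g T ω z)
      ((hmp.comp measurable_fst).mul (hg T))]
    · refine le_trans (lintegral_mono fun ω => ?_) ih
      have hgT : Measurable (g T ω) := (hg T).comp measurable_prodMk_left
      rw [lintegral_const_mul _ hgT]
      exact mul_le_of_le_one_right' (hle T ω)
    · intro ω ω' h
      have : ∏ t ∈ Finset.range T, g t ω (ω t) = ∏ t ∈ Finset.range T, g t ω' (ω' t) := by
        refine Finset.prod_congr rfl fun t ht => ?_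
        have ht' := Finset.mem_range.1 ht
        rw [h t ht', hdep t ω ω' fun s hs => h s (hs.trans ht')]
      rw [this, hdep T ω ω' h]

/-- Chernoff's bound for sums of adapted increments with a conditional exponential moment at
most `1`. -/
theorem measure_sum_ge_le_exp [NeZero K] {G : Problem X Y K N M} (O : G.Oracle) (n : ℕ → ℕ)
    {g : ℕ → (ℕ → Interaction X Y K) → Interaction X Y K → ℝ}
    (hg : ∀ t, Measurable (Function.uncurry (g t)))
    (hdep : ∀ t ω ω', (∀ s < t, ω s = ω' s) → g t ω = g t ω')
    (hint : ∀ t ω, Integrable (fun z => Real.exp (g t ω z)) (G.law (executedPolicy O n t ω)))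
    (hle : ∀ t ω, ∫ z, Real.exp (g t ω z) ∂G.law (executedPolicy O n t ω) ≤ 1) (T : ℕ) (a : ℝ) :
    runLaw O n {ω | a ≤ ∑ t ∈ Finset.range T, g t ω (ω t)} ≤ ENNReal.ofReal (Real.exp (-a)) := by
  have h := lintegral_prod_le_one O n (g := fun t ω z => ENNReal.ofReal (Real.exp (g t ω z)))
    (fun t => (Real.measurable_exp.comp (hg t)).ennreal_ofReal)
    (fun t ω ω' hω => by rw [hdep t ω ω' hω])
    (fun t ω => by
      rw [← ofReal_integral_eq_lintegral_ofReal (hint t ω) (.of_forall fun z => (Real.exp_pos _).le)]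
      exact ENNReal.ofReal_le_one.2 (hle t ω)) T
  have hprod : ∀ ω : ℕ → Interaction X Y K,
      ∏ t ∈ Finset.range T, ENNReal.ofReal (Real.exp (g t ω (ω t)))
        = ENNReal.ofReal (Real.exp (∑ t ∈ Finset.range T, g t ω (ω t))) := fun ω => by
    rw [Real.exp_sum, ENNReal.ofReal_prod_of_nonneg fun t _ => (Real.exp_pos _).le]
  simp only [hprod] at h
  have hmeas : Measurable fun ω : ℕ → Interaction X Y K =>
      ENNReal.ofReal (Real.exp (∑ t ∈ Finset.range T, g t ω (ω t))) :=
    (Real.measurable_exp.comp (Finset.measurable_sum _ fun t _ =>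
      (hg t).comp (measurable_id.prodMk (measurable_pi_apply t)))).ennreal_ofReal
  have hset : {ω : ℕ → Interaction X Y K | a ≤ ∑ t ∈ Finset.range T, g t ω (ω t)}
      = {ω | ENNReal.ofReal (Real.exp a)
        ≤ ENNReal.ofReal (Real.exp (∑ t ∈ Finset.range T, g t ω (ω t)))} := by
    ext ω
    simp only [Set.mem_ofPred_eq]
    rw [ENNReal.ofReal_le_ofReal_iff (Real.exp_pos _).le, Real.exp_le_exp]
  have hpos : ENNReal.ofReal (Real.exp a) ≠ 0 := (ENNReal.ofReal_pos.2 (Real.exp_pos a)).ne'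
  rw [hset]
  refine (meas_ge_le_lintegral_div hmeas.aemeasurable hpos ENNReal.ofReal_ne_top).trans ?_
  rw [Real.exp_neg, ENNReal.ofReal_inv_of_pos (Real.exp_pos a), ← one_div]
  exact ENNReal.div_le_div_right h _

/-- The Azuma–Hoeffding inequality for the realized rewards. -/
theorem measure_policyRegret_add_le_realizedRegret [NeZero K] {G : Problem X Y K N M}
    (O : G.Oracle) (n : ℕ → ℕ) (V : ℝ) {T : ℕ} (hT : 1 ≤ T) {u : ℝ}
    (hu : 0 ≤ u) :
    runLaw O n {ω | policyRegret O n V T ω + u ≤ G.realizedRegret V T ω}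
      ≤ ENNReal.ofReal (Real.exp (-(2 * u ^ 2 / T))) := by
  have hT0 : (0 : ℝ) < T := by exact_mod_cast hT
  -- the optimal parameter in the exponential moment
  set l : ℝ := 4 * u / T with hl
  have hmR : ∀ μ : Measure (Interaction X Y K), AEMeasurable (fun z => G.meanReward z.1) μ :=
    fun μ => (G.measurable_meanReward.comp measurable_fst).aemeasurable
  have hsub : ∀ t ω, HasSubgaussianMGF
      (fun z : Interaction X Y K => G.meanReward z.1 - G.value (executedPolicy O n t ω))
      ((‖(1 : ℝ) - 0‖₊ / 2) ^ 2) (G.law (executedPolicy O n t ω)) := fun t ω => by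
    have := hasSubgaussianMGF_of_mem_Icc (μ := G.law (executedPolicy O n t ω))
      (X := fun z => G.meanReward z.1) (hmR _) (.of_forall fun z => G.meanReward_mem z.1)
    rwa [integral_law_meanReward] at this
  have hexp : ∀ t ω (z : Interaction X Y K),
      Real.exp (l * (G.value (executedPolicy O n t ω) - G.meanReward z.1) - l ^ 2 / 8)
        = Real.exp (-l * (G.meanReward z.1 - G.value (executedPolicy O n t ω)))
          * Real.exp (-(l ^ 2 / 8)) := fun t ω z => by
    rw [← Real.exp_add]
    congr 1
    ring
  refine le_trans (measure_mono fun ω hω => ?_) (measure_sum_ge_le_exp O n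
    (g := fun t ω z => l * (G.value (executedPolicy O n t ω) - G.meanReward z.1) - l ^ 2 / 8)
    (fun t => ?_) (fun t ω ω' h => ?_) (fun t ω => ?_) (fun t ω => ?_) T (2 * u ^ 2 / T))
  · have hω' : policyRegret O n V T ω + u ≤ G.realizedRegret V T ω := hω
    unfold policyRegret realizedRegret at hω'
    change _ ≤ ∑ t ∈ Finset.range T,
      (l * (G.value (executedPolicy O n t ω) - G.meanReward (ω t).1) - l ^ 2 / 8)
    rw [Finset.sum_sub_distrib, ← Finset.mul_sum, Finset.sum_sub_distrib, Finset.sum_const,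
      Finset.card_range, nsmul_eq_mul]
    have hsum : u ≤ ∑ t ∈ Finset.range T, G.value (executedPolicy O n t ω)
        - ∑ t ∈ Finset.range T, G.meanReward (ω t).1 := by linarith
    have hl0 : 0 ≤ l := by positivity
    have e1 : l * u = 4 * u ^ 2 / T := by rw [hl]; ring
    have e2 : T * (l ^ 2 / 8) = 2 * u ^ 2 / T := by rw [hl]; field_simp; ring
    have e3 : 4 * u ^ 2 / T = 2 * u ^ 2 / T + 2 * u ^ 2 / T := by ring
    have := mul_le_mul_of_nonneg_left hsum hl0
    linarith
  · exact (((measurable_value_executedPolicy O n t).comp measurable_fst).sub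
      (G.measurable_meanReward.comp (measurable_fst.comp measurable_snd))).const_mul l
        |>.sub_const _
  · simp only [executedPolicy_congr O n t h]
  · simp only [hexp]
    exact ((hsub t ω).integrable_exp_mul (-l)).mul_const _
  · simp only [hexp]
    rw [integral_mul_const]
    have := (hsub t ω).mgf_le (-l)
    rw [Real.exp_neg, mul_inv_le_iff₀ (Real.exp_pos _), one_mul]
    refine this.trans_eq ?_
    congr 1
    simp
    ring

/-- In the expected regret, each reward can be replaced by the value of the executed policy, which
is its conditional mean given the past. -/
theorem regret_eq_sum_integral_value [NeZero K] {G : Problem X Y K N M} (O : G.Oracle)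
    (n : ℕ → ℕ) (V : ℝ) (T : ℕ) :
    regret O n V T = T * V
      - ∑ t ∈ Finset.range T, ∫ ω, G.value (executedPolicy O n t ω) ∂runLaw O n := by
  have hm : ∀ t : ℕ, Measurable fun ω : ℕ → Interaction X Y K => G.meanReward (ω t).1 := fun t =>
    G.measurable_meanReward.comp (measurable_fst.comp (measurable_pi_apply t))
  unfold regret
  rw [integral_finsetSum _ fun t _ => integrable_of_bound (c := 1) (hm t) fun ω => by
    rw [abs_of_nonneg (G.meanReward_mem _).1]
    exact (G.meanReward_mem _).2]
  congr 1
  refine Finset.sum_congr rfl fun t _ => ?_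
  rw [integral_eq_lintegral_of_nonneg_ae (.of_forall fun ω => (G.meanReward_mem _).1)
      (hm t).aestronglyMeasurable,
    integral_eq_lintegral_of_nonneg_ae (.of_forall fun ω => (G.value_mem _).1)
      (measurable_value_executedPolicy O n t).aestronglyMeasurable,
    lintegral_runLaw_step O n t (f := fun _ z => ENNReal.ofReal (G.meanReward z.1))
      (G.measurable_meanReward.comp (measurable_fst.comp measurable_snd)).ennreal_ofReal
      fun _ _ _ => rfl]
  congr 1
  refine lintegral_congr fun ω => ?_
  rw [← integral_law_meanReward, ofReal_integral_eq_lintegral_ofReal _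
    (.of_forall fun z => (G.meanReward_mem _).1)]
  exact integrable_of_bound (c := 1) (G.measurable_meanReward.comp measurable_fst) fun z => by
    rw [abs_of_nonneg (G.meanReward_mem _).1]
    exact (G.meanReward_mem _).2

end Problem

/-! ### Rounds and their exploration steps -/

@[simp]
theorem roundStart_one (n : ℕ → ℕ) : roundStart n 1 = 0 := by simp [roundStart]

theorem roundStart_succ (n : ℕ → ℕ) {i : ℕ} (hi : 1 ≤ i) :
    roundStart n (i + 1) = roundStart n i + (1 + n i) :=
  Finset.sum_Ico_succ_top hi _

theorem roundStart_lt (n : ℕ → ℕ) {i j : ℕ} (hi : 1 ≤ i) (hij : i < j) :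
    roundStart n i < roundStart n j := by
  have h1 := roundStart_succ n hi
  have h2 := roundStart_mono n (Nat.succ_le_of_lt hij)
  simp only [Nat.succ_eq_add_one] at h2
  omega

theorem le_roundStart_succ (n : ℕ → ℕ) (i : ℕ) : i ≤ roundStart n (i + 1) := by
  induction i with
  | zero => exact Nat.zero_le _
  | succ i ih =>
    have := roundStart_succ n (Nat.le_add_left 1 i)
    omega

theorem one_le_roundOf (n : ℕ → ℕ) (t : ℕ) : 1 ≤ roundOf n t :=
  Nat.le_findGreatest (by omega) (by simp)

theorem roundOf_le (n : ℕ → ℕ) (t : ℕ) : roundOf n t ≤ t + 1 := Nat.findGreatest_le _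

theorem lt_roundStart_roundOf_succ (n : ℕ → ℕ) (t : ℕ) : t < roundStart n (roundOf n t + 1) := by
  by_cases h : roundOf n t + 1 ≤ t + 1
  · exact not_le.1 (Nat.findGreatest_is_greatest (P := fun i => roundStart n i ≤ t)
      (Nat.lt_succ_self (roundOf n t)) h)
  · have := le_roundStart_succ n (roundOf n t)
    omega

theorem roundOf_eq {n : ℕ → ℕ} {t i : ℕ} (h1 : roundStart n i ≤ t)
    (h2 : t < roundStart n (i + 1)) : roundOf n t = i := by
  have h3 := roundStart_roundOf_le n t
  have h4 := lt_roundStart_roundOf_succ n t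
  rcases lt_trichotomy (roundOf n t) i with h | h | h
  · have := roundStart_mono n (Nat.succ_le_of_lt h)
    simp only [Nat.succ_eq_add_one] at this
    omega
  · exact h
  · have := roundStart_mono n (Nat.succ_le_of_lt h)
    simp only [Nat.succ_eq_add_one] at this
    omega

theorem roundOf_roundStart_add {n : ℕ → ℕ} {i s : ℕ} (hi : 1 ≤ i) (hs : s ≤ n i) :
    roundOf n (roundStart n i + s) = i :=
  roundOf_eq (Nat.le_add_right _ _) (by rw [roundStart_succ n hi]; omega)

theorem isExploration_roundStart (n : ℕ → ℕ) {i : ℕ} (hi : 1 ≤ i) :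
    IsExploration n (roundStart n i) := by
  unfold IsExploration
  rw [show roundOf n (roundStart n i) = i from roundOf_roundStart_add (s := 0) hi (Nat.zero_le _)]

theorem roundStart_succ_injective (n : ℕ → ℕ) :
    Function.Injective fun k => roundStart n (k + 1) :=
  StrictMono.injective fun _ _ h => roundStart_lt n (Nat.le_add_left 1 _) (Nat.succ_lt_succ h)

theorem filter_isExploration_range (n : ℕ → ℕ) {i : ℕ} (hi : 1 ≤ i) :
    (Finset.range (roundStart n i + 1)).filter (IsExploration n)
      = (Finset.range i).image fun k => roundStart n (k + 1) := by
  ext t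
  simp only [Finset.mem_filter, Finset.mem_range, Finset.mem_image]
  constructor
  · rintro ⟨h1, h2⟩
    have h3 := one_le_roundOf n t
    refine ⟨roundOf n t - 1, ?_, ?_⟩
    · by_contra! h
      have := roundStart_lt n hi (show i < roundOf n t by omega)
      unfold IsExploration at h2
      omega
    · rwa [Nat.sub_add_cancel h3]
  · rintro ⟨k, hk, rfl⟩
    exact ⟨Nat.lt_succ_of_le (roundStart_mono n hk), isExploration_roundStart n (by omega)⟩

theorem sum_range_isExploration (n : ℕ → ℕ) {i : ℕ} (hi : 1 ≤ i) (f : ℕ → ℝ) :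
    ∑ t ∈ Finset.range (roundStart n i + 1), (if IsExploration n t then f t else 0)
      = ∑ k ∈ Finset.range i, f (roundStart n (k + 1)) := by
  rw [← Finset.sum_filter, filter_isExploration_range n hi,
    Finset.sum_image (roundStart_succ_injective n).injOn]

theorem sum_range_roundStart (n : ℕ → ℕ) (h : ℕ → ℝ) (I : ℕ) :
    ∑ t ∈ Finset.range (roundStart n (I + 1)), (if IsExploration n t then 1 else h (roundOf n t))
      = ∑ i ∈ Finset.Icc 1 I, (1 + n i * h i) := by
  induction I with
  | zero => simp
  | succ I ih =>
    have hI : 1 ≤ I + 1 := Nat.le_add_left 1 I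
    rw [roundStart_succ n hI, Finset.sum_range_add, ih, Finset.sum_Icc_succ_top hI,
      Nat.add_comm 1 (n _), Finset.sum_range_succ', add_zero, if_pos (isExploration_roundStart n hI),
      add_comm (1 : ℝ)]
    congr 2
    have : ∀ s ∈ Finset.range (n (I + 1)),
        (if IsExploration n (roundStart n (I + 1) + (s + 1)) then 1
          else h (roundOf n (roundStart n (I + 1) + (s + 1)))) = h (I + 1) := fun s hs => by
      have hr := roundOf_roundStart_add (n := n) hI (Nat.succ_le_of_lt (Finset.mem_range.1 hs))
      simp only [Nat.succ_eq_add_one] at hr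
      rw [if_neg, hr]
      unfold IsExploration
      rw [hr]
      omega
    rw [Finset.sum_congr rfl this, Finset.sum_const, Finset.card_range, nsmul_eq_mul]

/-- A cost that is `1` at exploration steps and `h i` at the exploitation steps of round `i`,
summed over the time steps before `T`. -/
theorem sum_range_le_sum_rounds (n : ℕ → ℕ) {h : ℕ → ℝ} (hh : ∀ i, 0 ≤ h i) {T : ℕ} (hT : 1 ≤ T) :
    ∑ t ∈ Finset.range T, (if IsExploration n t then 1 else h (roundOf n t))
      ≤ ∑ i ∈ Finset.Icc 1 (roundOf n (T - 1)), (1 + n i * h i) := by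
  rw [← sum_range_roundStart]
  refine Finset.sum_le_sum_of_subset_of_nonneg (Finset.range_subset_range.2 ?_) fun t _ _ => ?_
  · have := lt_roundStart_roundOf_succ n (T - 1)
    omega
  · split_ifs
    · exact zero_le_one
    · exact hh _

/-! ### The regret of a schedule -/

theorem card_filter_le_floor {w : ℝ} (hw : 0 ≤ w) (I : ℕ) :
    (((Finset.Icc 1 I).filter fun i : ℕ => (i : ℝ) ≤ w).card : ℝ) ≤ w := by
  have hsub : ((Finset.Icc 1 I).filter fun i : ℕ => (i : ℝ) ≤ w) ⊆ Finset.Icc 1 ⌊w⌋₊ := by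
    intro i hi
    simp only [Finset.mem_filter, Finset.mem_Icc] at hi ⊢
    exact ⟨hi.1.1, Nat.le_floor hi.2⟩
  have := Finset.card_le_card hsub
  rw [Nat.card_Icc, Nat.add_sub_cancel] at this
  exact (Nat.cast_le.2 this).trans (Nat.floor_le hw)

/-- The number of rounds after the warm-up: the `i`-th of them takes at least `√(i / (K c))` steps,
so at most `O(L)` of them fit into `T` steps if `L ^ 3 = T ^ 2 K c`. -/
theorem card_rounds_le {K : ℕ} {c w L : ℝ} (hK : 1 ≤ K) (hc : 0 < c) (hL : 0 < L) {T : ℕ}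
    (hT : 1 ≤ T) (hL3 : L ^ 3 = (T : ℝ) ^ 2 * (K * c)) :
    (((Finset.Icc 1 (roundOf (schedule K c w) (T - 1))).filter fun i : ℕ => w < (i : ℝ)).card : ℝ)
      ≤ 1 + 2 * L := by
  set n := schedule K c w with hn
  set I := roundOf n (T - 1) with hI
  have hI1 : 1 ≤ I := one_le_roundOf n _
  have hKc : (0 : ℝ) < K * c := mul_pos (by exact_mod_cast hK) hc
  have hT0 : (0 : ℝ) < T := by exact_mod_cast hT
  set r := Real.sqrt (K * c / L) with hr
  have hr0 : 0 < r := Real.sqrt_pos.2 (by positivity)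
  have hTr : T * r = L := by
    have h1 : (T * r) ^ 2 = L ^ 2 := by
      rw [mul_pow, hr, Real.sq_sqrt (by positivity), ← mul_div_assoc, ← hL3]
      field_simp
    exact (sq_eq_sq₀ (by positivity) hL.le).1 h1
  -- rounds `i ≤ L` are at most `L` in number, all others are charged to their length
  have hround : ∀ i ∈ Finset.Ico 1 I, (if w < (i : ℝ) then (1 : ℝ) else 0)
      ≤ (if (i : ℝ) ≤ L then 1 else 0) + r * ((1 + n i : ℕ) : ℝ) := by
    intro i hi
    have hpos : 0 ≤ r * ((1 + n i : ℕ) : ℝ) := by positivity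
    split_ifs with h1 h2 h2
    · linarith
    · have h3 : n i = ⌊Real.sqrt (i / (K * c))⌋₊ := by
        rw [hn, schedule, if_neg (not_le.2 h1)]
      have h4 : Real.sqrt (L / (K * c)) ≤ ((1 + n i : ℕ) : ℝ) := by
        refine le_trans (Real.sqrt_le_sqrt ?_) (?_ : Real.sqrt (i / (K * c)) ≤ _)
        · exact div_le_div_of_nonneg_right (not_le.1 h2).le hKc.le
        · rw [h3]
          push_cast
          linarith [Nat.lt_floor_add_one (Real.sqrt (i / (K * c)))]
      have h5 : r * Real.sqrt (L / (K * c)) = 1 := by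
        rw [hr, ← Real.sqrt_mul (by positivity), show K * c / L * (L / (K * c)) = 1 by field_simp,
          Real.sqrt_one]
      linarith [mul_le_mul_of_nonneg_left h4 hr0.le]
    · linarith
    · linarith
  have hsum := Finset.sum_le_sum hround
  rw [Finset.sum_add_distrib, ← Finset.mul_sum, ← Nat.cast_sum] at hsum
  have hstart : ((∑ i ∈ Finset.Ico 1 I, (1 + n i) : ℕ) : ℝ) ≤ T := by
    have : roundStart n I ≤ T - 1 := roundStart_roundOf_le n _
    unfold roundStart at this
    exact_mod_cast this.trans (Nat.sub_le _ _)
  have hfirst : ∑ i ∈ Finset.Ico 1 I, (if (i : ℝ) ≤ L then (1 : ℝ) else 0) ≤ L := by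
    rw [Finset.sum_boole]
    refine le_trans (Nat.cast_le.2 (Finset.card_le_card (Finset.filter_subset_filter _ ?_)))
      (card_filter_le_floor hL.le I)
    exact Finset.Ico_subset_Icc_self
  have hsecond := mul_le_mul_of_nonneg_left hstart hr0.le
  rw [← Finset.sum_boole, ← Finset.Ico_insert_right hI1, Finset.sum_insert (by simp)]
  have hlast : (if w < (I : ℝ) then (1 : ℝ) else 0) ≤ 1 := by split_ifs <;> norm_num
  linarith

/-- The total cost up to time `T` when an exploitation step of round `i` costs `1` as long as
`i ≤ w'`, and `8 √(K c / i) / D` later on. -/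
theorem sum_cost_le {K : ℕ} {c w w' L D : ℝ} (hK : 1 ≤ K) (hc : 0 < c) (hL : 0 < L) (hw : 0 ≤ w)
    (hw' : 0 ≤ w') (hD : 0 < D) (hD1 : D ≤ 1) {T : ℕ} (hT : 1 ≤ T)
    (hL3 : L ^ 3 = (T : ℝ) ^ 2 * (K * c)) :
    ∑ t ∈ Finset.range T, (if IsExploration (schedule K c w) t then 1 else
        if (roundOf (schedule K c w) t : ℝ) ≤ w' then 1
        else 8 * Real.sqrt (K * c / roundOf (schedule K c w) t) / D)
      ≤ w + 9 / D * (1 + 2 * L) + if w < w' then w' * Real.sqrt (w' / (K * c)) else 0 := by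
  set n := schedule K c w with hn
  set I := roundOf n (T - 1) with hI
  have hKc : (0 : ℝ) < K * c := mul_pos (by exact_mod_cast hK) hc
  set h : ℕ → ℝ := fun i => if (i : ℝ) ≤ w' then 1 else 8 * Real.sqrt (K * c / i) / D with hh
  have h0 : ∀ i, 0 ≤ h i := fun i => by
    simp only [hh]
    split_ifs <;> positivity
  refine (sum_range_le_sum_rounds n h0 hT).trans ?_
  set a : ℝ := if w < w' then Real.sqrt (w' / (K * c)) else 0 with ha
  have hround : ∀ i ∈ Finset.Icc 1 I, 1 + n i * h i
      ≤ (if (i : ℝ) ≤ w then 1 else 0) + 9 / D * (if w < (i : ℝ) then 1 else 0)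
        + a * (if (i : ℝ) ≤ w' then 1 else 0) := by
    intro i hi
    have hi0 : (0 : ℝ) < i := by exact_mod_cast (Finset.mem_Icc.1 hi).1
    have ha0 : 0 ≤ a := by rw [ha]; split_ifs <;> positivity
    have h9 : 9 / D = 1 / D + 8 / D := by ring
    have h1D : 1 ≤ 1 / D := by rw [le_div_iff₀ hD]; linarith
    have h8D : 0 ≤ 8 / D := by positivity
    by_cases h1 : (i : ℝ) ≤ w
    · have : n i = 0 := by rw [hn, schedule, if_pos h1]
      rw [this, if_pos h1, if_neg (not_lt.2 h1)]
      split_ifs <;> simp [ha0]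
    · have h2 : (n i : ℝ) ≤ Real.sqrt (i / (K * c)) := by
        rw [hn, schedule, if_neg h1]
        exact Nat.floor_le (Real.sqrt_nonneg _)
      rw [if_neg h1, if_pos (not_le.1 h1)]
      by_cases h3 : (i : ℝ) ≤ w'
      · have h4 : a = Real.sqrt (w' / (K * c)) := by rw [ha, if_pos (by linarith)]
        have h5 : Real.sqrt (i / (K * c)) ≤ a := by
          rw [h4]
          exact Real.sqrt_le_sqrt (div_le_div_of_nonneg_right h3 hKc.le)
        simp only [hh]
        rw [if_pos h3, if_pos h3]
        linarith
      · simp only [hh]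
        rw [if_neg h3, if_neg h3]
        have h5 : Real.sqrt (i / (K * c)) * Real.sqrt (K * c / i) = 1 := by
          rw [← Real.sqrt_mul (by positivity),
            show i / (K * c) * (K * c / i) = 1 by field_simp, Real.sqrt_one]
        have h6 : n i * (8 * Real.sqrt (K * c / i) / D) ≤ 8 / D := by
          calc n i * (8 * Real.sqrt (K * c / i) / D)
              ≤ Real.sqrt (i / (K * c)) * (8 * Real.sqrt (K * c / i) / D) := by gcongr
            _ = 8 * (Real.sqrt (i / (K * c)) * Real.sqrt (K * c / i)) / D := by ring
            _ = 8 / D := by rw [h5, mul_one]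
        linarith
  refine (Finset.sum_le_sum hround).trans ?_
  rw [Finset.sum_add_distrib, Finset.sum_add_distrib, ← Finset.mul_sum, ← Finset.mul_sum,
    Finset.sum_boole, Finset.sum_boole, Finset.sum_boole]
  have h1 := card_filter_le_floor hw I
  have h2 := mul_le_mul_of_nonneg_left (card_rounds_le (w := w) hK hc hL hT hL3)
    (by positivity : 0 ≤ 9 / D)
  have h3 : a * (((Finset.Icc 1 I).filter fun i : ℕ => (i : ℝ) ≤ w').card : ℝ)
      ≤ if w < w' then w' * Real.sqrt (w' / (K * c)) else 0 := by
    rw [ha]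
    split_ifs
    · rw [mul_comm]
      exact mul_le_mul_of_nonneg_right (card_filter_le_floor hw' I) (Real.sqrt_nonneg _)
    · simp
  linarith

namespace Problem

variable {X Y : Type*} [MeasurableSpace X] [MeasurableSpace Y] {K N M : ℕ}

/-! ### Concentration of the exploration data -/

/-- Chernoff's bound for the exploration data of the rounds `1, …, i`. -/
theorem measure_exploration_sum_ge_le [NeZero K] {G : Problem X Y K N M} (O : G.Oracle) (n : ℕ → ℕ)
    {f : Interaction X Y K → ℝ} (hf : Measurable f) {l b : ℝ} (hl : 0 ≤ l)
    (hint : Integrable (fun z => Real.exp (l * f z)) (G.law (uniformPolicy X K)))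
    (hb : ∫ z, Real.exp (l * f z) ∂G.law (uniformPolicy X K) ≤ Real.exp b) {i : ℕ} (hi : 1 ≤ i)
    (e : ℝ) :
    runLaw O n {ω | i * e ≤ ∑ k ∈ Finset.range i, f (ω (roundStart n (k + 1)))}
      ≤ ENNReal.ofReal (Real.exp (-(i * (l * e - b)))) := by
  have hexp : ∀ z, Real.exp (l * f z - b) = Real.exp (l * f z) * Real.exp (-b) := fun z => by
    rw [← Real.exp_add, sub_eq_add_neg]
  refine le_trans (measure_mono fun ω hω => ?_) (measure_sum_ge_le_exp O n
    (g := fun t _ z => if IsExploration n t then l * f z - b else 0)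
    (fun t => ?_) (fun t ω ω' h => rfl) (fun t ω => ?_) (fun t ω => ?_) (roundStart n i + 1)
    (i * (l * e - b)))
  · have hω' : i * e ≤ ∑ k ∈ Finset.range i, f (ω (roundStart n (k + 1))) := hω
    change _ ≤ ∑ t ∈ Finset.range (roundStart n i + 1),
      (if IsExploration n t then l * f (ω t) - b else 0)
    rw [sum_range_isExploration n hi fun t => l * f (ω t) - b, Finset.sum_sub_distrib,
      ← Finset.mul_sum, Finset.sum_const, Finset.card_range, nsmul_eq_mul]
    linarith [mul_le_mul_of_nonneg_left hω' hl]
  · by_cases ht : IsExploration n t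
    · simp only [if_pos ht]
      exact ((hf.comp measurable_snd).const_mul l).sub_const b
    · simp only [if_neg ht]
      exact measurable_const
  · by_cases ht : IsExploration n t
    · simp only [if_pos ht, hexp, executedPolicy_of_isExploration O ht]
      exact hint.mul_const _
    · simp only [if_neg ht]
      exact integrable_const _
  · by_cases ht : IsExploration n t
    · simp only [if_pos ht, hexp, executedPolicy_of_isExploration O ht]
      rw [integral_mul_const, Real.exp_neg, mul_inv_le_iff₀ (Real.exp_pos _), one_mul]
      exact hb
    · simp [if_neg ht]

end Problem

theorem one_le_of_not_isExploration {n : ℕ → ℕ} {t : ℕ} (ht : ¬ IsExploration n t) :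
    1 ≤ n (roundOf n t) := by
  have h1 := roundStart_roundOf_le n t
  have h2 := lt_roundStart_roundOf_succ n t
  rw [roundStart_succ n (one_le_roundOf n t)] at h2
  unfold IsExploration at ht
  omega

theorem isExploration_zero (n : ℕ → ℕ) : IsExploration n 0 := by
  have := isExploration_roundStart n le_rfl
  rwa [roundStart_one] at this

theorem le_of_one_le_schedule {K : ℕ} {c w : ℝ} (hK : 1 ≤ K) (hc : 0 < c) {i : ℕ}
    (h : 1 ≤ schedule K c w i) : K * c ≤ (i : ℝ) := by
  have hKc : (0 : ℝ) < K * c := mul_pos (by exact_mod_cast hK) hc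
  unfold schedule at h
  split_ifs at h
  · omega
  · have h1 : (1 : ℝ) ≤ Real.sqrt (i / (K * c)) := by
      simpa using (Nat.le_floor_iff (Real.sqrt_nonneg _)).1 h
    rwa [Real.one_le_sqrt, one_le_div hKc] at h1

namespace Problem

variable {X Y : Type*} [MeasurableSpace X] [MeasurableSpace Y] {K N M : ℕ}

/-! ### Failure of a round -/

/-- The deviation of the score of `(p, q)` from its mean, in the direction that is harmful to the
oracle's choice: downwards for the optimal pair `(ps, qs)`, upwards for all other pairs. -/
noncomputable def deviation (G : Problem X Y K N M) [NeZero K] (ps : Fin N) (qs : Fin M)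
    (j : Fin N × Fin M) (z : Interaction X Y K) : ℝ :=
  (if j = (ps, qs) then -1 else 1) * (G.score j.1 j.2 (observe z)
    - ∫ z, G.score j.1 j.2 (observe z) ∂G.law (uniformPolicy X K))

theorem measurable_deviation (G : Problem X Y K N M) [NeZero K] (ps : Fin N) (qs : Fin M)
    (j : Fin N × Fin M) : Measurable (G.deviation ps qs j) :=
  (((G.measurable_score j.1 j.2).comp measurable_observe).sub_const _).const_mul _

theorem integrable_exp_deviation (G : Problem X Y K N M) [NeZero K] (ps : Fin N) (qs : Fin M)
    (j : Fin N × Fin M) (l : ℝ) :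
    Integrable (fun z => Real.exp (l * G.deviation ps qs j z)) (G.law (uniformPolicy X K)) := by
  have h := (hasSubgaussianMGF_of_mem_Icc (μ := G.law (uniformPolicy X K))
    ((G.measurable_score j.1 j.2).comp measurable_observe).aemeasurable
    (Filter.Eventually.of_forall fun z => G.score_mem j.1 j.2 (observe z))).integrable_exp_mul
    (l * if j = (ps, qs) then -1 else 1)
  simpa only [deviation, mul_assoc, Function.comp_apply] using h

theorem integral_exp_deviation_le_hoeffding (G : Problem X Y K N M) [NeZero K] (ps : Fin N)
    (qs : Fin M) (j : Fin N × Fin M) (l : ℝ) :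
    ∫ z, Real.exp (l * G.deviation ps qs j z) ∂G.law (uniformPolicy X K)
      ≤ Real.exp ((K : ℝ) ^ 2 * l ^ 2 / 8) := by
  have h := G.integral_exp_score_le_hoeffding j.1 j.2 (l * if j = (ps, qs) then -1 else 1)
  have hs : (l * if j = (ps, qs) then -1 else 1) ^ 2 = l ^ 2 := by split_ifs <;> ring
  rw [hs] at h
  simpa only [deviation, mul_assoc] using h

theorem integral_exp_deviation_le_bernstein (G : Problem X Y K N M) [NeZero K] (ps : Fin N)
    (qs : Fin M) (j : Fin N × Fin M) {l : ℝ} (hl : |l| * K ≤ 1) :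
    ∫ z, Real.exp (l * G.deviation ps qs j z) ∂G.law (uniformPolicy X K)
      ≤ Real.exp ((K : ℝ) * l ^ 2) := by
  have hs : (l * if j = (ps, qs) then -1 else 1) ^ 2 = l ^ 2 := by split_ifs <;> ring
  have hs' : |l * if j = (ps, qs) then -1 else 1| = |l| := by split_ifs <;> simp
  have h := G.integral_exp_score_le_bernstein j.1 j.2 (l := l * if j = (ps, qs) then -1 else 1)
    (by rwa [hs'])
  rw [hs] at h
  simpa only [deviation, mul_assoc] using h

/-- The deviations on the exploration data of the rounds `1, …, i` exceed `i e` for some pair. -/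
def deviationEvent (G : Problem X Y K N M) [NeZero K] (n : ℕ → ℕ) (ps : Fin N) (qs : Fin M)
    (i : ℕ) (e : ℝ) : Set (ℕ → Interaction X Y K) :=
  ⋃ j, {ω | i * e ≤ ∑ k ∈ Finset.range i, G.deviation ps qs j (ω (roundStart n (k + 1)))}

theorem measurableSet_deviationEvent (G : Problem X Y K N M) [NeZero K] (n : ℕ → ℕ) (ps : Fin N)
    (qs : Fin M) (i : ℕ) (e : ℝ) : MeasurableSet (G.deviationEvent n ps qs i e) :=
  MeasurableSet.iUnion fun j => measurableSet_le measurable_const <|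
    Finset.measurable_sum _ fun _ _ => (G.measurable_deviation ps qs j).comp (measurable_pi_apply _)

/-- A union bound over the pairs. Since only one direction matters for each pair, there are `N M`
events. -/
theorem measure_deviationEvent_le [NeZero K] {G : Problem X Y K N M} (O : G.Oracle) (n : ℕ → ℕ)
    (ps : Fin N) (qs : Fin M) {i : ℕ} (hi : 1 ≤ i) {l b e a : ℝ} (hl : 0 ≤ l)
    (hb : ∀ j, ∫ z, Real.exp (l * G.deviation ps qs j z) ∂G.law (uniformPolicy X K) ≤ Real.exp b)
    (ha : a ≤ i * (l * e - b)) :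
    runLaw O n (G.deviationEvent n ps qs i e) ≤ ENNReal.ofReal (N * M * Real.exp (-a)) := by
  refine (measure_iUnion_fintype_le _ _).trans ?_
  refine (Finset.sum_le_sum (g := fun _ => ENNReal.ofReal (Real.exp (-a))) fun j _ =>
    (measure_exploration_sum_ge_le O n (G.measurable_deviation ps qs j) hl
      (G.integrable_exp_deviation ps qs j l) (hb j) hi e).trans ?_).trans_eq ?_
  · exact ENNReal.ofReal_le_ofReal (Real.exp_le_exp.2 (neg_le_neg ha))
  · rw [Finset.sum_const, Finset.card_univ, Fintype.card_prod, Fintype.card_fin, Fintype.card_fin,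
      nsmul_eq_mul, ENNReal.ofReal_mul (by positivity), ← Nat.cast_mul, ENNReal.ofReal_natCast]

/-- Round `i`, which has exploitation steps and comes after the warm-up, fails: the deviations
exceed either `η / 2`, so that a decoder of the wrong sign might be selected, or `4 √(K c / i)`. -/
noncomputable def failure (G : Problem X Y K N M) [NeZero K] (n : ℕ → ℕ) (ps : Fin N) (qs : Fin M)
    (c η : ℝ) (i : ℕ) : Set (ℕ → Interaction X Y K) :=
  if 2 * (K : ℝ) ^ 2 * c / η ^ 2 < i ∧ K * c ≤ (i : ℝ) then
    G.deviationEvent n ps qs i (η / 2) ∪ G.deviationEvent n ps qs i (4 * Real.sqrt (K * c / i))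
  else ∅

theorem measurableSet_failure (G : Problem X Y K N M) [NeZero K] (n : ℕ → ℕ) (ps : Fin N)
    (qs : Fin M) (c η : ℝ) (i : ℕ) : MeasurableSet (G.failure n ps qs c η i) := by
  unfold failure
  split_ifs
  · exact (G.measurableSet_deviationEvent n ps qs i _).union
      (G.measurableSet_deviationEvent n ps qs i _)
  · exact MeasurableSet.empty

theorem measure_failure_le [NeZero K] {G : Problem X Y K N M} (O : G.Oracle) (n : ℕ → ℕ)
    (ps : Fin N) (qs : Fin M) {c η : ℝ} (hc : 0 < c) (hc2 : 2 ≤ Real.exp c) (hη : 0 < η) {i : ℕ}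
    (hi : 1 ≤ i) :
    runLaw O n (G.failure n ps qs c η i) ≤ ENNReal.ofReal (5 / 4 * (N * M * Real.exp (-c))) := by
  unfold failure
  split_ifs with h
  · have hi0 : (0 : ℝ) < i := by exact_mod_cast hi
    have hK : (0 : ℝ) < K := by exact_mod_cast NeZero.pos K
    have h1 : runLaw O n (G.deviationEvent n ps qs i (η / 2))
        ≤ ENNReal.ofReal (N * M * Real.exp (-c)) := by
      -- `l = 4 e / K ^ 2` with `e = η / 2` minimizes Hoeffding's exponent
      refine measure_deviationEvent_le O n ps qs hi (l := 2 * η / (K : ℝ) ^ 2) (by positivity)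
        (fun j => G.integral_exp_deviation_le_hoeffding ps qs j _) ?_
      have e1 : i * (2 * η / (K : ℝ) ^ 2 * (η / 2) - (K : ℝ) ^ 2 * (2 * η / (K : ℝ) ^ 2) ^ 2 / 8)
          = i * η ^ 2 / (2 * (K : ℝ) ^ 2) := by
        field_simp
        ring
      rw [e1, le_div_iff₀ (by positivity)]
      have := h.1.le
      rw [div_le_iff₀ (by positivity)] at this
      linarith
    have h2 : runLaw O n (G.deviationEvent n ps qs i (4 * Real.sqrt (K * c / i)))
        ≤ ENNReal.ofReal (N * M * Real.exp (-(3 * c))) := by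
      have hs : Real.sqrt (c / (K * i)) * Real.sqrt (K * c / i) = c / i := by
        rw [← Real.sqrt_mul (by positivity), show c / (K * i) * (K * c / i) = (c / i) ^ 2 by
          field_simp, Real.sqrt_sq (by positivity)]
      have hs2 : (K : ℝ) * Real.sqrt (c / (K * i)) ^ 2 = c / i := by
        rw [Real.sq_sqrt (by positivity)]
        field_simp
      -- `K * c ≤ i` makes `l ≤ 1 / K`, as Bernstein's bound requires
      refine measure_deviationEvent_le O n ps qs hi (l := Real.sqrt (c / (K * i)))
        (Real.sqrt_nonneg _) (fun j => G.integral_exp_deviation_le_bernstein ps qs j ?_) ?_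
      · rw [abs_of_nonneg (Real.sqrt_nonneg _)]
        refine abs_le_one_iff_mul_self_le_one.2 ?_ |> (le_abs_self _).trans
        calc Real.sqrt (c / (K * i)) * K * (Real.sqrt (c / (K * i)) * K)
            = K * (K * Real.sqrt (c / (K * i)) ^ 2) := by ring
          _ = K * c / i := by rw [hs2]; ring
          _ ≤ 1 := by rw [div_le_one hi0]; exact h.2
      · rw [hs2, show Real.sqrt (c / (K * i)) * (4 * Real.sqrt (K * c / i))
          = 4 * (Real.sqrt (c / (K * i)) * Real.sqrt (K * c / i)) by ring, hs]
        apply le_of_eq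
        field_simp
        ring
    have h3 : Real.exp (-(3 * c)) ≤ 1 / 4 * Real.exp (-c) := by
      have e1 : Real.exp (-(3 * c)) = (Real.exp c)⁻¹ ^ 2 * Real.exp (-c) := by
        rw [← Real.exp_neg, ← Real.exp_nat_mul, ← Real.exp_add]
        congr 1
        push_cast
        ring
      rw [e1]
      refine mul_le_mul_of_nonneg_right ?_ (Real.exp_pos _).le
      have e2 : (Real.exp c)⁻¹ ≤ 1 / 2 := by
        rw [inv_le_comm₀ (Real.exp_pos c) (by norm_num)]
        norm_num
        exact hc2
      have e3 : 0 ≤ (Real.exp c)⁻¹ := (inv_pos.2 (Real.exp_pos c)).le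
      nlinarith
    refine (measure_union_le _ _).trans ((add_le_add h1 h2).trans ?_)
    rw [← ENNReal.ofReal_add (by positivity) (by positivity)]
    refine ENNReal.ofReal_le_ofReal ?_
    have : (N * M : ℝ) * Real.exp (-(3 * c)) ≤ N * M * (1 / 4 * Real.exp (-c)) :=
      mul_le_mul_of_nonneg_left h3 (by positivity)
    linarith
  · simp

/-! ### The regret of an exploitation step -/

/-- The identifiability assumption in terms of real numbers: `v`, `d` are the value of a policy and
the gap of a decoder whose product objective is `η`-optimal. As `d` cannot be negative, the policy
is nearly optimal. -/
theorem value_gap_le {v vs vb d ds η e : ℝ} (hv : 0 ≤ v) (hvb : 0 ≤ vb) (hd : |d| ≤ 1)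
    (hdds : d ≤ ds) (hds : 0 < ds) (hid : vb + η ≤ (vs - vb) * ds)
    (h1 : ds * (vs - vb) - η < d * (v - vb)) (h2 : ds * (vs - vb) - e < d * (v - vb)) :
    vs - v ≤ e / ds := by
  have hpos : vb < d * (v - vb) := by linarith
  have hd0 : 0 < d := by
    by_contra! hneg
    have := (abs_le.1 hd).1
    nlinarith [mul_nonneg (neg_nonneg.2 hneg) hv, mul_nonneg (by linarith : 0 ≤ 1 + d) hvb]
  have hvv : 0 < v - vb := by
    by_contra! hneg
    nlinarith
  rw [le_div_iff₀ hds]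
  nlinarith

/-- As in `value_gap_le`, a negative gap could not reach the product that identifiability demands. -/
theorem decoderGap_pos (G : Problem X Y K N M) [NeZero K] {ps : Fin N} {qs : Fin M} {η : ℝ}
    (hη : 0 < η)
    (hid : G.value (uniformPolicy X K) + η
      ≤ (G.value (G.policy ps) - G.value (uniformPolicy X K)) * G.decoderGap qs) :
    0 < G.decoderGap qs := by
  by_contra! hneg
  have h1 := (G.value_mem (uniformPolicy X K)).1
  have h2 := (G.value_mem (G.policy ps)).1
  have h3 := (abs_le.1 (G.abs_decoderGap_le_one qs)).1
  nlinarith [mul_nonneg (neg_nonneg.2 hneg) h2, mul_nonneg (by linarith : 0 ≤ 1 + G.decoderGap qs) h1]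

/-- Without large deviations, the objective of the selected pair is nearly optimal. -/
theorem objective_gap_lt {G : Problem X Y K N M} [NeZero K] (O : G.Oracle) {n : ℕ → ℕ}
    {ps : Fin N} {qs : Fin M} {t : ℕ} (ht : ¬ IsExploration n (t + 1))
    {ω : ℕ → Interaction X Y K} {e : ℝ}
    (hω : ω ∉ G.deviationEvent n ps qs (roundOf n (t + 1)) e)
    (hne : O.select _ (exploreData ht fun s => ω s) ≠ (ps, qs)) :
    ∫ z, G.score ps qs (observe z) ∂G.law (uniformPolicy X K) - 2 * e
      < ∫ z, G.score (O.select _ (exploreData ht fun s => ω s)).1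
          (O.select _ (exploreData ht fun s => ω s)).2 (observe z) ∂G.law (uniformPolicy X K) := by
  set i := roundOf n (t + 1) with hi
  set j := O.select _ (exploreData ht fun s => ω s) with hj
  have hi0 : (0 : ℝ) < i := by exact_mod_cast one_le_roundOf n (t + 1)
  simp only [deviationEvent, Set.mem_iUnion, Set.mem_ofPred_eq, not_exists, not_le] at hω
  have h1 := hω j
  have h2 := hω (ps, qs)
  simp only [deviation, if_neg hne, if_true] at h1 h2
  rw [← Finset.mul_sum, Finset.sum_sub_distrib, Finset.sum_const, Finset.card_range, nsmul_eq_mul]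
    at h1 h2
  have h3 := O.isMax i (exploreData ht fun s => ω s) ps qs
  rw [← hj, objective_eq, objective_eq, div_le_div_iff_of_pos_right hi0] at h3
  have h4 : ∀ p q, ∑ k, G.score p q (exploreData ht (fun s => ω s) k)
      = ∑ k ∈ Finset.range i, G.score p q (observe (ω (roundStart n (k + 1)))) := fun p q =>
    (Finset.sum_range fun k => G.score p q (observe (ω (roundStart n (k + 1))))).symm
  rw [h4, h4] at h3
  refine lt_of_mul_lt_mul_left ?_ hi0.le
  linarith

/-- After the warm-up, the regret of an exploitation step of round `i` is at most
`8 √(K c / i) / Δψ⋆` unless the round fails. -/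
theorem value_learnedPolicy_ge {G : Problem X Y K N M} [NeZero K] (O : G.Oracle) {n : ℕ → ℕ}
    {ps : Fin N} {qs : Fin M} {c η : ℝ} (hG : G.CondIndepFeedback)
    (hqs : ∀ q, G.decoderGap q ≤ G.decoderGap qs) (hη : 0 < η)
    (hid : G.value (uniformPolicy X K) + η
      ≤ (G.value (G.policy ps) - G.value (uniformPolicy X K)) * G.decoderGap qs)
    {t : ℕ} (ht : ¬ IsExploration n (t + 1)) {ω : ℕ → Interaction X Y K}
    (hw : 2 * (K : ℝ) ^ 2 * c / η ^ 2 < roundOf n (t + 1)) (hKc : K * c ≤ (roundOf n (t + 1) : ℝ))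
    (hω : ω ∉ G.failure n ps qs c η (roundOf n (t + 1))) :
    G.value (G.policy ps) - G.value (G.policy (learnedPolicy O ht fun s => ω s))
      ≤ 8 * Real.sqrt (K * c / roundOf n (t + 1)) / G.decoderGap qs := by
  have hpos := G.decoderGap_pos hη hid
  rw [failure, if_pos ⟨hw, hKc⟩, Set.mem_union, not_or] at hω
  by_cases hne : O.select _ (exploreData ht fun s => ω s) = (ps, qs)
  · have : learnedPolicy O ht (fun s => ω s) = ps := by rw [learnedPolicy, hne]
    rw [this, sub_self]
    positivity
  · have h1 := objective_gap_lt O ht hω.1 hne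
    have h2 := objective_gap_lt O ht hω.2 hne
    rw [integral_score G hG, integral_score G hG] at h1 h2
    unfold learnedPolicy
    set j := O.select _ (exploreData ht fun s => ω s)
    exact value_gap_le (G.value_mem _).1 (G.value_mem _).1 (G.abs_decoderGap_le_one j.2) (hqs j.2)
      hpos hid (by linarith) (by linarith)

/-- The bound on the regret of time step `t`, valid unless the round of `t` fails. -/
noncomputable def stepCost (n : ℕ → ℕ) (K : ℕ) (c w D : ℝ) (t : ℕ) : ℝ :=
  if IsExploration n t then 1 else if (roundOf n t : ℝ) ≤ w then 1
    else 8 * Real.sqrt (K * c / roundOf n t) / D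

theorem value_executedPolicy_ge {G : Problem X Y K N M} [NeZero K] (O : G.Oracle)
    {ps : Fin N} {qs : Fin M} {c η w : ℝ} (hG : G.CondIndepFeedback)
    (hqs : ∀ q, G.decoderGap q ≤ G.decoderGap qs) (hη : 0 < η)
    (hid : G.value (uniformPolicy X K) + η
      ≤ (G.value (G.policy ps) - G.value (uniformPolicy X K)) * G.decoderGap qs)
    (hc : 0 < c) (t : ℕ) {ω : ℕ → Interaction X Y K}
    (hω : ω ∉ G.failure (schedule K c w) ps qs c η (roundOf (schedule K c w) t)) :
    G.value (G.policy ps) - G.value (executedPolicy O (schedule K c w) t ω)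
      ≤ stepCost (schedule K c w) K c (2 * (K : ℝ) ^ 2 * c / η ^ 2) (G.decoderGap qs) t := by
  have htriv : G.value (G.policy ps) - G.value (executedPolicy O (schedule K c w) t ω) ≤ 1 := by
    linarith [(G.value_mem (G.policy ps)).2,
      (G.value_mem (executedPolicy O (schedule K c w) t ω)).1]
  unfold stepCost
  split_ifs with h1 h2
  · exact htriv
  · exact htriv
  · cases t with
    | zero => exact absurd (isExploration_zero _) h1
    | succ t =>
      rw [executedPolicy_of_not_isExploration O h1]
      exact value_learnedPolicy_ge O hG hqs hη hid h1 (not_le.1 h2)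
        (le_of_one_le_schedule NeZero.one_le hc (one_le_of_not_isExploration h1)) hω

end Problem

/-! ### Explicit bounds -/

theorem exp_neg_complexityTerm {T N M : ℕ} {δ : ℝ} (hT : 1 ≤ T) (hN : 1 ≤ N) (hM : 1 ≤ M)
    (hδ : 0 < δ) : Real.exp (-complexityTerm T N M δ) = δ / (2 * T * M * N) := by
  have hT' : (0 : ℝ) < T := by exact_mod_cast hT
  have hN' : (0 : ℝ) < N := by exact_mod_cast hN
  have hM' : (0 : ℝ) < M := by exact_mod_cast hM
  rw [complexityTerm, Real.exp_neg, Real.exp_log (by positivity), inv_div]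

theorem two_le_exp_complexityTerm {T N M : ℕ} {δ : ℝ} (hT : 1 ≤ T) (hN : 1 ≤ N) (hM : 1 ≤ M)
    (hδ : 0 < δ) (hδ1 : δ < 1) : 2 ≤ Real.exp (complexityTerm T N M δ) := by
  have hT' : (1 : ℝ) ≤ T := by exact_mod_cast hT
  have hN' : (1 : ℝ) ≤ N := by exact_mod_cast hN
  have hM' : (1 : ℝ) ≤ M := by exact_mod_cast hM
  rw [complexityTerm, Real.exp_log (by positivity), le_div_iff₀ hδ]
  have : (1 : ℝ) ≤ T * M * N := one_le_mul_of_one_le_of_one_le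
    (one_le_mul_of_one_le_of_one_le hT' hM') hN'
  nlinarith

theorem half_le_of_two_le_exp {c : ℝ} (h : 2 ≤ Real.exp c) : 1 / 2 ≤ c := by
  have h1 := Real.log_le_log (by norm_num) h
  rw [Real.log_exp] at h1
  linarith [Real.log_two_gt_d9]

/-- The horizon from which on the warm-up of length `E = 2 K² / η²` suffices: it makes `E ^ (3 / 2)`,
the cost of the rounds up to `c E` divided by `c`, at most `T ^ (2 / 3)`. -/
noncomputable def shortWarmupHorizon (K : ℕ) (η : ℝ) : ℕ :=
  ⌈(2 * (K : ℝ) ^ 2 / η ^ 2 * Real.sqrt (2 * (K : ℝ) ^ 2 / η ^ 2)) ^ (3 / 2 : ℝ)⌉₊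

theorem sqrt_two_mul_le {K T : ℕ} {c : ℝ} (hK : 1 ≤ K) (hT : 1 ≤ T) (hc : 1 / 2 ≤ c) :
    Real.sqrt (2 * T * c) ≤ 2 * c * ((K : ℝ) ^ (1 / 3 : ℝ) * (T : ℝ) ^ (2 / 3 : ℝ)) := by
  have hK' : (1 : ℝ) ≤ K := by exact_mod_cast hK
  have hT' : (1 : ℝ) ≤ T := by exact_mod_cast hT
  have h1 : Real.sqrt T ≤ (T : ℝ) ^ (2 / 3 : ℝ) := by
    rw [Real.sqrt_eq_rpow]
    exact Real.rpow_le_rpow_of_exponent_le hT' (by norm_num)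
  have h2 : Real.sqrt (2 * c) ≤ 2 * c := Real.sqrt_le_iff.2 ⟨by linarith, by nlinarith⟩
  have h3 : (1 : ℝ) ≤ (K : ℝ) ^ (1 / 3 : ℝ) := Real.one_le_rpow hK' (by norm_num)
  have h4 : (0 : ℝ) ≤ (T : ℝ) ^ (2 / 3 : ℝ) := by positivity
  rw [show 2 * T * c = 2 * c * (T : ℝ) by ring, Real.sqrt_mul (by linarith)]
  exact mul_le_mul h2 (h1.trans (le_mul_of_one_le_left h4 h3)) (Real.sqrt_nonneg _) (by linarith)

theorem sum_stepCost_le {K T : ℕ} {c η D w : ℝ} (hK : 1 ≤ K) (hT : 1 ≤ T) (hc : 1 / 2 ≤ c)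
    (hη : 0 < η) (hD : 0 < D) (hD1 : D ≤ 1)
    (hw : w = 2 * (K : ℝ) ^ 2 * c / η ^ 2 ∨
      (w = 2 * (K : ℝ) ^ 2 / η ^ 2 ∧ shortWarmupHorizon K η ≤ T)) :
    ∑ t ∈ Finset.range T,
        Problem.stepCost (schedule K c w) K c (2 * (K : ℝ) ^ 2 * c / η ^ 2) D t
      ≤ 55 * c * ((K : ℝ) ^ (1 / 3 : ℝ) * (T : ℝ) ^ (2 / 3 : ℝ) / D + 2 * (K : ℝ) ^ 2 / η ^ 2) := by
  have hK' : (1 : ℝ) ≤ K := by exact_mod_cast hK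
  have hT' : (1 : ℝ) ≤ T := by exact_mod_cast hT
  have hc0 : 0 < c := by linarith
  set E : ℝ := 2 * (K : ℝ) ^ 2 / η ^ 2 with hE
  set Q : ℝ := (K : ℝ) ^ (1 / 3 : ℝ) * (T : ℝ) ^ (2 / 3 : ℝ) with hQ
  have hE0 : 0 < E := by positivity
  have hw'E : 2 * (K : ℝ) ^ 2 * c / η ^ 2 = c * E := by rw [hE]; ring
  rw [hw'E] at hw ⊢
  have hT23 : (T : ℝ) ^ (2 / 3 : ℝ) ≤ Q :=
    le_mul_of_one_le_left (by positivity) (Real.one_le_rpow hK' (by norm_num))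
  have hQ1 : 1 ≤ Q := (Real.one_le_rpow hT' (by norm_num)).trans hT23
  set L : ℝ := Q * c ^ (1 / 3 : ℝ) with hL
  have hL0 : 0 < L := by positivity
  have hcube : ∀ x : ℝ, 0 ≤ x → (x ^ (1 / 3 : ℝ)) ^ 3 = x := fun x hx => by
    rw [← Real.rpow_natCast, ← Real.rpow_mul hx]
    norm_num
  have hL3 : L ^ 3 = (T : ℝ) ^ 2 * (K * c) := by
    have hT3 : ((T : ℝ) ^ (2 / 3 : ℝ)) ^ 3 = (T : ℝ) ^ 2 := by
      rw [← Real.rpow_natCast, ← Real.rpow_mul (by positivity), ← Real.rpow_natCast]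
      norm_num
    rw [hL, hQ, mul_pow, mul_pow, hcube _ (by positivity), hcube _ hc0.le, hT3]
    ring
  have hLQ : L ≤ 2 * c * Q := by
    have : c ^ (1 / 3 : ℝ) ≤ 2 * c := by
      refine le_of_pow_le_pow_left₀ (n := 3) (by norm_num) (by positivity) ?_
      rw [hcube _ hc0.le]
      nlinarith [mul_nonneg hc0.le (by nlinarith : 0 ≤ 8 * c ^ 2 - 1)]
    rw [hL, mul_comm]
    exact mul_le_mul_of_nonneg_right this (by positivity)
  have hw0 : 0 ≤ w := by
    rcases hw with h | h
    · rw [h]; positivity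
    · rw [h.1]; exact hE0.le
  have hwE : w ≤ 2 * c * E := by
    rcases hw with h | h
    · rw [h]; nlinarith
    · rw [h.1]; nlinarith
  have hextra : (if w < c * E then c * E * Real.sqrt (c * E / (K * c)) else 0) ≤ c * Q := by
    split_ifs with hlt
    · rcases hw with h | h
      · exact absurd hlt (by rw [h]; exact lt_irrefl _)
      · have h1 : Real.sqrt (c * E / (K * c)) ≤ Real.sqrt E := by
          refine Real.sqrt_le_sqrt ?_
          rw [div_le_iff₀ (by positivity)]
          nlinarith [mul_nonneg (mul_nonneg hc0.le hE0.le) (sub_nonneg.2 hK')]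
        have h2 : E * Real.sqrt E ≤ (T : ℝ) ^ (2 / 3 : ℝ) := by
          have h3 : (E * Real.sqrt E) ^ (3 / 2 : ℝ) ≤ T :=
            (Nat.le_ceil _).trans (Nat.cast_le.2 h.2)
          have h4 := Real.rpow_le_rpow (by positivity) h3 (by norm_num : (0 : ℝ) ≤ 2 / 3)
          rw [← Real.rpow_mul (by positivity)] at h4
          norm_num at h4
          convert h4 using 2
        calc c * E * Real.sqrt (c * E / (K * c)) ≤ c * E * Real.sqrt E := by gcongr
          _ = c * (E * Real.sqrt E) := by ring
          _ ≤ c * Q := by gcongr; exact h2.trans hT23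
    · positivity
  refine (sum_cost_le hK hc0 hL0 hw0 (by positivity) hD hD1 hT hL3).trans ?_
  have h1 : 9 / D * (1 + 2 * L) ≤ 54 * c * (Q / D) := by
    have : 1 + 2 * L ≤ 6 * c * Q := by nlinarith
    calc 9 / D * (1 + 2 * L) ≤ 9 / D * (6 * c * Q) := by gcongr
      _ = 54 * c * (Q / D) := by ring
  have h2 : c * Q ≤ c * (Q / D) := by
    refine mul_le_mul_of_nonneg_left ?_ hc0.le
    rw [le_div_iff₀ hD]
    nlinarith
  nlinarith [mul_pos hc0 hE0]

namespace Problem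

variable {X Y : Type*} [MeasurableSpace X] [MeasurableSpace Y] {K N M : ℕ}

/-! ### The three regret bounds -/

theorem policyRegret_le_sum {G : Problem X Y K N M} [NeZero K] (O : G.Oracle)
    {ps : Fin N} {qs : Fin M} {c η w : ℝ} (hG : G.CondIndepFeedback)
    (hqs : ∀ q, G.decoderGap q ≤ G.decoderGap qs) (hη : 0 < η)
    (hid : G.value (uniformPolicy X K) + η
      ≤ (G.value (G.policy ps) - G.value (uniformPolicy X K)) * G.decoderGap qs)
    (hc : 0 < c) {T : ℕ} {ω : ℕ → Interaction X Y K}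
    (hω : ∀ i ∈ Finset.Icc 1 T, ω ∉ G.failure (schedule K c w) ps qs c η i) :
    policyRegret O (schedule K c w) (G.value (G.policy ps)) T ω
      ≤ ∑ t ∈ Finset.range T,
        stepCost (schedule K c w) K c (2 * (K : ℝ) ^ 2 * c / η ^ 2) (G.decoderGap qs) t := by
  have h : policyRegret O (schedule K c w) (G.value (G.policy ps)) T ω
      = ∑ t ∈ Finset.range T,
        (G.value (G.policy ps) - G.value (executedPolicy O (schedule K c w) t ω)) := by
    rw [Finset.sum_sub_distrib, Finset.sum_const, Finset.card_range, nsmul_eq_mul, policyRegret]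
  rw [h]
  refine Finset.sum_le_sum fun t ht => value_executedPolicy_ge O hG hqs hη hid hc t (hω _ ?_)
  have := Finset.mem_range.1 ht
  exact Finset.mem_Icc.2 ⟨one_le_roundOf _ _, (roundOf_le _ _).trans this⟩

/-- In expectation, the failure of a round is charged only to its own steps, so no union bound over
the rounds is needed. -/
theorem regret_le_sum_add {G : Problem X Y K N M} [NeZero K] (O : G.Oracle)
    {ps : Fin N} {qs : Fin M} {c η w a : ℝ} (hG : G.CondIndepFeedback)
    (hqs : ∀ q, G.decoderGap q ≤ G.decoderGap qs) (hη : 0 < η)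
    (hid : G.value (uniformPolicy X K) + η
      ≤ (G.value (G.policy ps) - G.value (uniformPolicy X K)) * G.decoderGap qs)
    (hc : 0 < c) (ha : 0 ≤ a) (hfail : ∀ i, 1 ≤ i →
      runLaw O (schedule K c w) (G.failure (schedule K c w) ps qs c η i) ≤ ENNReal.ofReal a)
    (T : ℕ) :
    regret O (schedule K c w) (G.value (G.policy ps)) T
      ≤ ∑ t ∈ Finset.range T,
        stepCost (schedule K c w) K c (2 * (K : ℝ) ^ 2 * c / η ^ 2) (G.decoderGap qs) t + T * a := by
  set n := schedule K c w with hn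
  have hstep : ∀ t ∈ Finset.range T, G.value (G.policy ps)
      - ∫ ω, G.value (executedPolicy O n t ω) ∂runLaw O n
      ≤ stepCost n K c (2 * (K : ℝ) ^ 2 * c / η ^ 2) (G.decoderGap qs) t + a := fun t _ => by
    set F := G.failure n ps qs c η (roundOf n t) with hF
    have hFm : MeasurableSet F := G.measurableSet_failure n ps qs c η _
    have hpt : ∀ ω, G.value (G.policy ps) - stepCost n K c (2 * (K : ℝ) ^ 2 * c / η ^ 2)
        (G.decoderGap qs) t - F.indicator (fun _ => 1) ω ≤ G.value (executedPolicy O n t ω) := by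
      intro ω
      by_cases hω : ω ∈ F
      · rw [Set.indicator_of_mem hω]
        have h1 : 0 ≤ stepCost n K c (2 * (K : ℝ) ^ 2 * c / η ^ 2) (G.decoderGap qs) t := by
          have := G.decoderGap_pos hη hid
          unfold stepCost
          split_ifs <;> positivity
        linarith [(G.value_mem (G.policy ps)).2, (G.value_mem (executedPolicy O n t ω)).1]
      · rw [Set.indicator_of_notMem hω]
        linarith [value_executedPolicy_ge O (w := w) hG hqs hη hid hc t hω]
    have hind : Integrable (F.indicator fun _ => (1 : ℝ)) (runLaw O n) :=
      (integrable_const _).indicator hFm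
    have hval : Integrable (fun ω => G.value (executedPolicy O n t ω)) (runLaw O n) :=
      integrable_of_bound (c := 1) (measurable_value_executedPolicy O n t) fun ω => by
        rw [abs_of_nonneg (G.value_mem _).1]
        exact (G.value_mem _).2
    have hint := integral_mono (μ := runLaw O n) ((integrable_const _).sub hind) hval hpt
    simp only [Pi.sub_apply] at hint
    rw [integral_sub (integrable_const _) hind, integral_indicator_const _ hFm, integral_const,
      probReal_univ, one_smul, smul_eq_mul, mul_one] at hint
    have hFa : (runLaw O n).real F ≤ a :=
      ENNReal.toReal_le_of_le_ofReal ha (hfail _ (one_le_roundOf n t))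
    linarith
  have hsum := Finset.sum_le_sum hstep
  rw [Finset.sum_sub_distrib, Finset.sum_add_distrib, Finset.sum_const, Finset.sum_const,
    Finset.card_range, nsmul_eq_mul, nsmul_eq_mul] at hsum
  rw [regret_eq_sum_integral_value]
  exact hsum

theorem measure_iUnion_failure_le [NeZero K] {G : Problem X Y K N M} (O : G.Oracle) (n : ℕ → ℕ)
    (ps : Fin N) (qs : Fin M) {c η a : ℝ} (hfail : ∀ i, 1 ≤ i →
      runLaw O n (G.failure n ps qs c η i) ≤ ENNReal.ofReal a) (T : ℕ) :
    runLaw O n (⋃ i ∈ Finset.Icc 1 T, G.failure n ps qs c η i) ≤ ENNReal.ofReal (T * a) := by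
  refine (measure_biUnion_finset_le _ _).trans ((Finset.sum_le_sum fun i hi =>
    hfail i (Finset.mem_Icc.1 hi).1).trans_eq ?_)
  rw [Finset.sum_const, Nat.card_Icc, Nat.add_sub_cancel, nsmul_eq_mul,
    ENNReal.ofReal_mul (Nat.cast_nonneg _), ENNReal.ofReal_natCast]

theorem ofReal_one_sub_le {α : Type*} [MeasurableSpace α] {μ : Measure α} [IsProbabilityMeasure μ]
    {s t : Set α} {δ : ℝ} (hδ : 0 ≤ δ) (ht : μ t ≤ ENNReal.ofReal δ) (hst : ∀ x, x ∉ t → x ∈ s) :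
    ENNReal.ofReal (1 - δ) ≤ μ s := by
  rw [ENNReal.ofReal_sub _ hδ, ENNReal.ofReal_one, tsub_le_iff_right]
  calc (1 : ENNReal) = μ Set.univ := measure_univ.symm
    _ ≤ μ (s ∪ t) := measure_mono fun x _ => by
        by_cases hx : x ∈ t
        · exact Or.inr hx
        · exact Or.inl (hst x hx)
    _ ≤ μ s + μ t := measure_union_le _ _
    _ ≤ μ s + ENNReal.ofReal δ := by gcongr

end Problem

end IGL

theorem theorem2 :
    ∃ (C : ℝ) (m : ℕ) (T₀ : ℕ → ℝ → ℕ), 0 < C ∧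
      ∀ (X : Type*) (Y : Type*) [MeasurableSpace X] [MeasurableSpace Y]
        (K N M : ℕ) [NeZero K] (G : IGL.Problem X Y K N M) (O : G.Oracle)
        (pstar : Fin N) (qstar : Fin M) (η δ : ℝ) (T : ℕ) (w : ℝ)
        (n : ℕ → ℕ) (V B : ℝ),
        -- conditional independence
        G.CondIndepFeedback →
        -- `pstar` is an optimal policy, `qstar` an optimal decoder
        (∀ p, G.value (G.policy p) ≤ G.value (G.policy pstar)) →
        (∀ q, G.decoderGap q ≤ G.decoderGap qstar) →
        -- identifiability
        0 < η →
        G.value (IGL.uniformPolicy X K) + η ≤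
          (G.value (G.policy pstar) - G.value (IGL.uniformPolicy X K)) * G.decoderGap qstar →
        0 < δ → δ < 1 → 1 ≤ T →
        -- the schedule, with its warm-up length `w`
        (w = 2 * (K : ℝ) ^ 2 * IGL.complexityTerm T N M δ / η ^ 2 ∨
          (w = 2 * (K : ℝ) ^ 2 / η ^ 2 ∧ T₀ K η ≤ T)) →
        n = IGL.schedule K (IGL.complexityTerm T N M δ) w →
        -- the optimal value and the bound on the regret
        V = G.value (G.policy pstar) →
        B = C * IGL.complexityTerm T N M δ ^ m *
          ((K : ℝ) ^ (1 / 3 : ℝ) * (T : ℝ) ^ (2 / 3 : ℝ) / G.decoderGap qstar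
            + 2 * (K : ℝ) ^ 2 / η ^ 2) →
        IGL.Problem.regret O n V T ≤ B ∧
        ENNReal.ofReal (1 - δ) ≤
          IGL.Problem.runLaw O n {ω | IGL.Problem.policyRegret O n V T ω ≤ B} ∧
        ENNReal.ofReal (1 - δ) ≤
          IGL.Problem.runLaw O n {ω | G.realizedRegret V T ω ≤ B} := by
  -- `55` for the step costs, and `2` each for the failures and for Azuma's deviation
  refine ⟨60, 1, IGL.shortWarmupHorizon, by norm_num, ?_⟩
  intro X Y _ _ K N M _ G O ps qs η δ T w n V B hG _ hqs hη hid hδ hδ1 hT hw hn hV hB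
  have hK : 1 ≤ K := NeZero.one_le
  have hN : 1 ≤ N := ps.pos
  have hM : 1 ≤ M := qs.pos
  have hT0 : (0 : ℝ) < T := by exact_mod_cast hT
  have hN0 : (1 : ℝ) ≤ N := by exact_mod_cast hN
  have hM0 : (1 : ℝ) ≤ M := by exact_mod_cast hM
  have hexp := IGL.exp_neg_complexityTerm hT hN hM hδ
  have hc2 := IGL.two_le_exp_complexityTerm hT hN hM hδ hδ1
  set c := IGL.complexityTerm T N M δ
  have hc := IGL.half_le_of_two_le_exp hc2
  have hc0 : 0 < c := by linarith
  have hD := G.decoderGap_pos hη hid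
  have hD1 : G.decoderGap qs ≤ 1 := (abs_le.1 (G.abs_decoderGap_le_one qs)).2
  have hcost := IGL.sum_stepCost_le hK hT hc hη hD hD1 hw
  have hsq := IGL.sqrt_two_mul_le hK hT hc
  set D := G.decoderGap qs
  set S := ∑ t ∈ Finset.range T,
    IGL.Problem.stepCost (IGL.schedule K c w) K c (2 * (K : ℝ) ^ 2 * c / η ^ 2) D t
  set Q : ℝ := (K : ℝ) ^ (1 / 3 : ℝ) * (T : ℝ) ^ (2 / 3 : ℝ)
  have hE : 0 ≤ 2 * (K : ℝ) ^ 2 / η ^ 2 := by positivity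
  have hQ1 : 1 ≤ Q := one_le_mul_of_one_le_of_one_le
    (Real.one_le_rpow (by exact_mod_cast hK) (by norm_num))
    (Real.one_le_rpow (by exact_mod_cast hT) (by norm_num))
  have hQD : Q ≤ Q / D := by
    rw [le_div_iff₀ hD]
    nlinarith
  have hcE := mul_nonneg hc0.le hE
  have hcQ := mul_le_mul_of_nonneg_left hQD hc0.le
  have hcQ1 := mul_le_mul hc hQ1 zero_le_one hc0.le
  rw [pow_one] at hB
  -- a round fails with probability at most `5 δ / (8 T)`
  have hfail : ∀ i, 1 ≤ i → IGL.Problem.runLaw O n (G.failure n ps qs c η i)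
      ≤ ENNReal.ofReal (5 * δ / (8 * T)) := fun i hi => by
    refine (IGL.Problem.measure_failure_le O n ps qs hc0 hc2 hη hi).trans_eq ?_
    congr 1
    rw [hexp]
    field_simp
    norm_num
  have hTa : T * (5 * δ / (8 * T)) = 5 / 8 * δ := by field_simp
  have hunion := IGL.Problem.measure_iUnion_failure_le O n ps qs hfail T
  rw [hTa] at hunion
  subst hn
  have hgood : ∀ ω, ω ∉ (⋃ i ∈ Finset.Icc 1 T, G.failure (IGL.schedule K c w) ps qs c η i) →
      IGL.Problem.policyRegret O (IGL.schedule K c w) V T ω ≤ S := fun ω hω => by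
    rw [hV]
    refine IGL.Problem.policyRegret_le_sum O hG hqs hη hid hc0 fun i hi hf => hω ?_
    exact Set.mem_biUnion hi hf
  refine ⟨?_, ?_, ?_⟩
  · have h := IGL.Problem.regret_le_sum_add O hG hqs hη hid hc0 (by positivity) hfail T
    rw [hTa, ← hV] at h
    linarith
  · refine IGL.Problem.ofReal_one_sub_le hδ.le (hunion.trans
      (ENNReal.ofReal_le_ofReal (by linarith))) fun ω hω => ?_
    have h := hgood ω hω
    change _ ≤ B
    linarith
  · have haz := IGL.Problem.measure_policyRegret_add_le_realizedRegret O (IGL.schedule K c w) V hT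
      (Real.sqrt_nonneg (2 * T * c))
    have haz' : Real.exp (-(2 * Real.sqrt (2 * T * c) ^ 2 / T)) ≤ 1 / 8 * δ := by
      have h1 : 2 * Real.sqrt (2 * T * c) ^ 2 / T = 4 * c := by
        rw [Real.sq_sqrt (by positivity)]
        field_simp
        ring
      have h2 : Real.exp (-c) ≤ δ / 2 := by
        rw [hexp]
        refine div_le_div_of_nonneg_left hδ.le (by norm_num) ?_
        have hT1 : (1 : ℝ) ≤ T := by exact_mod_cast hT
        have := one_le_mul_of_one_le_of_one_le (one_le_mul_of_one_le_of_one_le hT1 hM0) hN0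
        nlinarith
      have h3 : Real.exp (-c) ≤ 1 / 2 := by linarith
      have h4 := Real.exp_pos (-c)
      rw [h1, show -(4 * c) = ((4 : ℕ) : ℝ) * -c by push_cast; ring, Real.exp_nat_mul]
      have h5 : Real.exp (-c) ^ 2 ≤ 1 / 4 := by nlinarith
      calc Real.exp (-c) ^ 4 = Real.exp (-c) ^ 2 * Real.exp (-c) * Real.exp (-c) := by ring
        _ ≤ 1 / 4 * (1 / 2) * (δ / 2) := by gcongr
        _ ≤ 1 / 8 * δ := by linarith
    refine IGL.Problem.ofReal_one_sub_le hδ.le (t := (⋃ i ∈ Finset.Icc 1 T,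
        G.failure (IGL.schedule K c w) ps qs c η i) ∪ {ω |
        IGL.Problem.policyRegret O (IGL.schedule K c w) V T ω + Real.sqrt (2 * T * c)
          ≤ G.realizedRegret V T ω}) ?_ fun ω hω => ?_
    · refine (measure_union_le _ _).trans ((add_le_add hunion
        (haz.trans (ENNReal.ofReal_le_ofReal haz'))).trans ?_)
      rw [← ENNReal.ofReal_add (by positivity) (by positivity)]
      exact ENNReal.ofReal_le_ofReal (by linarith)
    · rw [Set.mem_union, not_or] at hω
      have h1 := hgood ω hω.1
      have h2 : G.realizedRegret V T ω
          < IGL.Problem.policyRegret O (IGL.schedule K c w) V T ω + Real.sqrt (2 * T * c) :=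
        not_le.1 hω.2
      change _ ≤ B
      linarith
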